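/- Let $n \ge 2$, let $B$ be the open unit ball of $\mathbb{R}^n$, write $x = (x', x_n)$ with $x' \in \mathbb{R}^{n-1}$ for Cartesian coordinates and $e_n$ for the last standard unit vector. Let $g$ be a smooth Riemannian metric on $\mathbb{R}^n$ with $g_{jk}(x) = \delta_{jk}$ for $|x| \ge 1$. Then the following conditions are equivalent. (1.4) There is $\omega \in C^\infty(\overline{B})$ with $|d\omega|_g := \sqrt{g^{jk}\,\partial_j\omega\,\partial_k\omega} = 1$ in $B$ and $\omega = x_n$ to infinite order on $\partial B$ (that is, $\omega$ and the function $x_n$ have the same derivatives of every order, including order $0$, at each point of $\partial B$). (1.4a) $\mathbb{R}^n$ is smoothly parametrized by the $g$-geodesics starting from $\{x_n = -1\}$ in direction $e_n$: there are $g$-geodesics $\gamma_{x'} : \mathbb{R} \to \mathbb{R}^n$, $x' \in \mathbb{R}^{n-1}$, with $\gamma_{x'}(-1) = (x', -1)$ and $\dot\gamma_{x'}(-1) = e_n$ (hence of unit speed), such that $(x', t) \mapsto \gamma_{x'}(t)$ is a smooth diffeomorphism of $\mathbb{R}^n$ onto $\mathbb{R}^n$; moreover, any geodesic $\gamma : \mathbb{R}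 \to \mathbb{R}^n$ with $\gamma(-1) \in \{x_n = -1\}$ and $\dot\gamma(-1) = e_n$ meets $\{x_n = 1\}$, and $\dot\gamma(t) = e_n$ whenever $\gamma(t) \in \{x_n = 1\}$. (1.4b) There is a global coordinate system $y = (y', y_n)$ on $\mathbb{R}^n$ with $\partial_{y_n} = \partial_{x_n}$ on $\mathbb{R}^n \setminus B$ such that in these coordinates $g(y) = \begin{pmatrix} g_0(y) & 0 \\ 0 & 1 \end{pmatrix}$, i.e. $g(\partial_{y_n}, \partial_{y_n}) = 1$ and $g(\partial_{y_a}, \partial_{y_n}) = 0$ for $1 \le a \le n-1$, everywhere. In (1.4b) a global coordinate system may be read either as a smooth diffeomorphism $y$ of $\mathbb{R}^n$ onto $\mathbb{R}^n$, or more generally as a smooth diffeomorphism $y$ of $\mathbb{R}^n$ onto some open subset of $\mathbb{R}^n$; the equivalence holds for both readings. -/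

import Mathlib

open scoped ContDiff Manifold
open Set Metric

namespace FixedAngle

/-- Euclidean space `ℝⁿ` with `n = m + 1`; the last coordinate is `x_n`. -/
abbrev Space (m : ℕ) : Type := EuclideanSpace ℝ (Fin (m + 1))

/-- The `j`-th standard unit vector. -/
noncomputable def unitVec {m : ℕ} (j : Fin (m + 1)) : Space m := EuclideanSpace.single j 1

/-- The point `(x', t)` of `ℝⁿ = ℝⁿ⁻¹ × ℝ`. -/
noncomputable def point {m : ℕ} (x' : EuclideanSpace ℝ (Fin m)) (t : ℝ) : Space m :=
  WithLp.toLp 2 (Fin.snoc (α := fun _ => ℝ) (fun i => x' i) t)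

/-- A smooth Riemannian metric on `ℝⁿ`, given by its components `g_{jk}` in Cartesian
coordinates. -/
structure IsSmoothMetric {m : ℕ}
    (g : Space m → Matrix (Fin (m + 1)) (Fin (m + 1)) ℝ) : Prop where
  smooth : ∀ j k, ContDiff ℝ ∞ (fun x => g x j k)
  posDef : ∀ x, (g x).PosDef

/-- The inner product `g_x(v, w) = g_{jk}(x) v^j w^k`. -/
noncomputable def metricInner {m : ℕ}
    (g : Space m → Matrix (Fin (m + 1)) (Fin (m + 1)) ℝ) (x v w : Space m) : ℝ :=
  ∑ j, ∑ k, g x j k * v j * w k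

/-- The `g`-norm `|ξ|_g = √(g^{jk}(x) ξ_j ξ_k)` of a covector `ξ` at `x`. -/
noncomputable def covectorNorm {m : ℕ}
    (g : Space m → Matrix (Fin (m + 1)) (Fin (m + 1)) ℝ) (x : Space m)
    (ξ : Space m →L[ℝ] ℝ) : ℝ :=
  √(∑ j, ∑ k, (g x)⁻¹ j k * ξ (unitVec j) * ξ (unitVec k))

/-- The partial derivative `∂_j f`. -/
noncomputable def partialDeriv {m : ℕ} (j : Fin (m + 1)) (f : Space m → ℝ) (x : Space m) : ℝ :=
  fderiv ℝ f x (unitVec j)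

/-- The Christoffel symbol
`Γ^k_{ij} = ½ g^{kl} (∂_i g_{jl} + ∂_j g_{il} - ∂_l g_{ij})` of the Levi-Civita connection. -/
noncomputable def christoffel {m : ℕ}
    (g : Space m → Matrix (Fin (m + 1)) (Fin (m + 1)) ℝ) (k i j : Fin (m + 1))
    (x : Space m) : ℝ :=
  (1 / 2) * ∑ l, (g x)⁻¹ k l *
    (partialDeriv i (fun z => g z j l) x + partialDeriv j (fun z => g z i l) x
      - partialDeriv l (fun z => g z i j) x)

/-- A (complete, affinely parametrized) `g`-geodesic `γ : ℝ → ℝⁿ`. -/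
def IsGeodesic {m : ℕ} (g : Space m → Matrix (Fin (m + 1)) (Fin (m + 1)) ℝ)
    (γ : ℝ → Space m) : Prop :=
  ContDiff ℝ ∞ γ ∧ ∀ t k,
    deriv (deriv γ) t k
      + ∑ i, ∑ j, christoffel g k i j (γ t) * deriv γ t i * deriv γ t j = 0

/-- There is `u ∈ C^∞(B̄)` with `|du|_g = 1` in `B` and `u = x_n` to infinite order on `∂B`. -/
def HasEikonal {m : ℕ} (g : Space m → Matrix (Fin (m + 1)) (Fin (m + 1)) ℝ) : Prop :=
  ∃ u : Space m → ℝ,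
    ContDiffOn ℝ ∞ u (closedBall 0 1) ∧
    (∀ x ∈ ball (0 : Space m) 1, covectorNorm g x (fderiv ℝ u x) = 1) ∧
    (∀ x ∈ sphere (0 : Space m) 1, ∀ k : ℕ,
      iteratedFDerivWithin ℝ k u (closedBall 0 1) x
        = iteratedFDeriv ℝ k (fun z : Space m => z (Fin.last m)) x)

/-- `ℝⁿ` is smoothly parametrized by `g`-geodesics starting (at time `-1`) from `{x_n = -1}` in
direction `e_n`, that is `(x', t) ↦ γ_{x'}(t)` is a diffeomorphism of `ℝⁿ`; and any such geodesic
meets `{x_n = 1}`, pointing in direction `e_n` there. -/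
def HasGeodesicParametrization {m : ℕ}
    (g : Space m → Matrix (Fin (m + 1)) (Fin (m + 1)) ℝ) : Prop :=
  (∃ F : Space m ≃ₘ[ℝ] Space m, ∀ x' : EuclideanSpace ℝ (Fin m),
    IsGeodesic g (fun t => F (point x' t)) ∧
    F (point x' (-1)) = point x' (-1) ∧
    deriv (fun t => F (point x' t)) (-1) = unitVec (Fin.last m)) ∧
  (∀ γ : ℝ → Space m, IsGeodesic g γ →
    γ (-1) (Fin.last m) = -1 → deriv γ (-1) = unitVec (Fin.last m) →
    (∃ t, γ t (Fin.last m) = 1) ∧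
    ∀ t, γ t (Fin.last m) = 1 → deriv γ t = unitVec (Fin.last m))

/-- `y` is a global smooth coordinate system on `ℝⁿ`: a diffeomorphism of `ℝⁿ` onto an open subset
`y.target` of `ℝⁿ`. -/
def IsGlobalCoordinates {m : ℕ} (y : OpenPartialHomeomorph (Space m) (Space m)) : Prop :=
  y.source = univ ∧ ContDiff ℝ ∞ y ∧ ContDiffOn ℝ ∞ y.symm y.target

/-- The coordinate vector field `∂_{y_a}`, evaluated at the point `x`. -/
noncomputable def coordVector {m : ℕ} (y : OpenPartialHomeomorph (Space m) (Space m))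
    (a : Fin (m + 1)) (x : Space m) : Space m :=
  fderiv ℝ y.symm (y x) (unitVec a)

/-- `y` is a global coordinate system with `∂_{y_n} = ∂_{x_n}` outside `B` in which the matrix of
`g` has the block form `diag(g₀, 1)`. -/
def IsSemigeodesic {m : ℕ} (g : Space m → Matrix (Fin (m + 1)) (Fin (m + 1)) ℝ)
    (y : OpenPartialHomeomorph (Space m) (Space m)) : Prop :=
  IsGlobalCoordinates y ∧
  (∀ x, x ∉ ball (0 : Space m) 1 → coordVector y (Fin.last m) x = unitVec (Fin.last m)) ∧
  ∀ x,
    metricInner g x (coordVector y (Fin.last m) x) (coordVector y (Fin.last m) x) = 1 ∧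
    ∀ a, a ≠ Fin.last m →
      metricInner g x (coordVector y a x) (coordVector y (Fin.last m) x) = 0

end FixedAngle

/-! The three kinds of data determine one another: geodesics leaving {x_n = -1} along e_n are the
integral curves of the gradient of ω, and y_n and ω differ by a constant.

From an eikonal solution: flatness of ω - x_n on the sphere gives a smooth global f, equal to x_n
outside the ball, with |df|_g = 1. Differentiating |∇f|² = 1 and using symmetry of the Hessian shows
that integral curves of ∇f are geodesics. Since ∇f - e_n has compact support, ∇f has a complete
smooth flow, along which f grows at unit rate. So flowing from {x_n = -1} is a diffeomorphism whose
inverse reads the time off f. As f has no critical points, |f| < 1 in the ball, hence the levels f =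
±1 are the planes x_n = ±1 (`HasEikonal.hasGeodesicParametrization`).

From the geodesics to coordinates: take y to be the inverse of the parametrization. Constant speed
and the Gauss lemma (`metricInner_fderiv_eq_zero`) give the block form. Outside the ball geodesics
are straight, and any exterior point is joined to a start or end plane by a segment avoiding the
ball, so the velocity there is e_n (`IsGeodesic.deriv_eq_of_one_le_norm`).

From coordinates to an eikonal solution: the block form says that ∂_{y_n} is the gradient of y_n.
Outside the ball dy_n = dx_n, and the exterior is connected because n ≥ 2, so y_n minus a constant
works (`IsSemigeodesic.hasEikonal`). -/

namespace ContinuousMap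

/-! ### Smoothness of superposition operators on spaces of continuous functions -/

section Superposition

universe u

variable {X : Type*} [TopologicalSpace X] [CompactSpace X]
  {E F : Type u} [NormedAddCommGroup E] [NormedSpace ℝ E] [NormedAddCommGroup F] [NormedSpace ℝ F]

/-- Pointwise application of a continuous family of linear maps, as a bounded bilinear map. -/
noncomputable def pointwiseApply (X : Type*) [TopologicalSpace X] [CompactSpace X]
    (E F : Type u) [NormedAddCommGroup E] [NormedSpace ℝ E]
    [NormedAddCommGroup F] [NormedSpace ℝ F] :
    C(X, E →L[ℝ] F) →L[ℝ] C(X, E) →L[ℝ] C(X, F) :=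
  LinearMap.mkContinuous₂
    (LinearMap.mk₂ ℝ
      (fun (A : C(X, E →L[ℝ] F)) (h : C(X, E)) =>
        (⟨fun x => A x (h x), by fun_prop⟩ : C(X, F)))
      (fun _ _ _ => by ext; simp) (fun _ _ _ => by ext; simp)
      (fun _ _ _ => by ext; simp) (fun _ _ _ => by ext; simp))
    1 (by
      intro A h
      rw [ContinuousMap.norm_le _ (by positivity)]
      intro x
      rw [one_mul]
      exact ((A x).le_opNorm _).trans
        (mul_le_mul (A.norm_coe_le_norm x) (h.norm_coe_le_norm x) (norm_nonneg _) (norm_nonneg A)))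

@[simp]
theorem pointwiseApply_apply (A : C(X, E →L[ℝ] F)) (h : C(X, E)) (x : X) :
    pointwiseApply X E F A h x = A x (h x) := rfl

/-- The range of α is compact, so f' is uniformly continuous at it. The mean value inequality then
bounds the remainder at all points of X simultaneously, which is what the sup norm demands. -/
theorem hasFDerivAt_comp_left {f : E → F} {f' : E → E →L[ℝ] F} (hf : ∀ x, HasFDerivAt f (f' x) x)
    (hf' : Continuous f') (α : C(X, E)) :
    HasFDerivAt
      (fun β : C(X, E) => (⟨f, continuous_iff_continuousAt.2 fun x => (hf x).continuousAt⟩ :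
        C(E, F)).comp β)
      (pointwiseApply X E F ((⟨f', hf'⟩ : C(E, E →L[ℝ] F)).comp α)) α := by
  rw [hasFDerivAt_iff_isLittleO_nhds_zero, Asymptotics.isLittleO_iff]
  intro c hc
  have hK : IsCompact (range α) := isCompact_range α.continuous
  have hu := hK.uniformContinuousAt_of_continuousAt f' (fun a _ => hf'.continuousAt)
    (dist_mem_uniformity hc)
  obtain ⟨δ, hδ, hδ'⟩ := mem_uniformity_dist.1 hu
  filter_upwards [ball_mem_nhds (0 : C(X, E)) hδ] with h hh
  rw [ContinuousMap.norm_le _ (by positivity)]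
  intro x
  have hx : ‖h x‖ < δ := (h.norm_coe_le_norm x).trans_lt (by simpa using hh)
  have key := (convex_ball (α x) δ).norm_image_sub_le_of_norm_hasFDerivWithin_le'
    (f := f) (f' := f') (φ := f' (α x)) (C := c) (x := α x) (y := α x + h x)
    (fun y _ => (hf y).hasFDerivWithinAt) (fun y hy => by
      have := hδ' (a := α x) (b := y) (by rwa [dist_comm]) (mem_range_self x)
      rw [← dist_eq_norm, dist_comm]
      exact le_of_lt this) (mem_ball_self hδ) (by simpa using hx)
  simp only [add_sub_cancel_left] at key
  exact key.trans (mul_le_mul_of_nonneg_left (h.norm_coe_le_norm x) hc.le)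

/-- The derivative is superposition with f' followed by a bounded linear map, so induction on the
order applies. The target F must vary in the induction, since f' takes values in E →L F; a common
universe for E and F keeps that space in range. -/
theorem contDiff_nat_comp_left (n : ℕ) :
    ∀ {F : Type u} [NormedAddCommGroup F] [NormedSpace ℝ F] {f : E → F} (hf : ContDiff ℝ n f),
      ContDiff ℝ n (fun β : C(X, E) => (⟨f, hf.continuous⟩ : C(E, F)).comp β) := by
  induction n with
  | zero =>
    intro F _ _ f hf
    exact contDiff_zero.2 (ContinuousMap.continuous_postcomp _)
  | succ n ih =>
    intro F _ _ f hf
    obtain ⟨f', hf', hd⟩ := contDiff_succ_iff_hasFDerivAt.1 hf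
    refine contDiff_succ_iff_hasFDerivAt.2 ⟨_, ?_, fun α => hasFDerivAt_comp_left hd hf'.continuous α⟩
    exact (pointwiseApply X E F).contDiff.comp (ih hf')

/-- Superposition with a smooth map is smooth on the space of continuous functions. -/
theorem contDiff_comp_left {f : E → F} (hf : ContDiff ℝ ∞ f) :
    ContDiff ℝ ∞ (fun β : C(X, E) => (⟨f, hf.continuous⟩ : C(E, F)).comp β) :=
  contDiff_infty.2 fun n => contDiff_nat_comp_left n (hf.of_le (mod_cast le_top))

end Superposition

/-! ### Integration as a bounded operator on the unit interval -/

section Primitive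

variable {E : Type*} [NormedAddCommGroup E] [NormedSpace ℝ E]

theorem continuous_comp_projIcc {E : Type*} [NormedAddCommGroup E] (β : C(unitInterval, E)) :
    Continuous fun r : ℝ => β (projIcc 0 1 zero_le_one r) :=
  β.continuous.comp continuous_projIcc

/-- The primitive vanishing at `0` of a continuous function on the unit interval. -/
noncomputable def primitive (E : Type*) [NormedAddCommGroup E] [NormedSpace ℝ E] :
    C(unitInterval, E) →L[ℝ] C(unitInterval, E) :=
  LinearMap.mkContinuous
    { toFun := fun β => ⟨fun s => ∫ r in (0 : ℝ)..s, β (projIcc 0 1 zero_le_one r),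
        (intervalIntegral.continuous_primitive
          (fun _ _ => (continuous_comp_projIcc β).intervalIntegrable _ _) 0).comp
          continuous_subtype_val⟩
      map_add' := fun β₁ β₂ => by
        ext s
        simpa using intervalIntegral.integral_add
          ((continuous_comp_projIcc β₁).intervalIntegrable 0 (s : ℝ))
          ((continuous_comp_projIcc β₂).intervalIntegrable 0 (s : ℝ))
      map_smul' := fun c β => by
        ext s
        simp }
    1 (by
      intro β
      rw [ContinuousMap.norm_le _ (by positivity)]
      intro s
      have := intervalIntegral.norm_integral_le_of_norm_le_const (a := (0 : ℝ)) (b := s)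
        (C := ‖β‖) (f := fun r => β (projIcc 0 1 zero_le_one r))
        (fun r _ => β.norm_coe_le_norm _)
      refine this.trans ?_
      rw [one_mul, sub_zero, abs_of_nonneg s.2.1]
      exact mul_le_of_le_one_right (norm_nonneg _) s.2.2)

@[simp]
theorem primitive_apply (β : C(unitInterval, E)) (s : unitInterval) :
    primitive E β s = ∫ r in (0 : ℝ)..s, β (projIcc 0 1 zero_le_one r) := rfl

theorem norm_primitive_le : ‖primitive E‖ ≤ 1 :=
  LinearMap.mkContinuous_norm_le _ zero_le_one _

end Primitive

end ContinuousMap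

/-! ### Global flows of bounded Lipschitz fields and their smooth dependence on time and initial
point -/

namespace ODE

variable {E : Type*} [NormedAddCommGroup E] [NormedSpace ℝ E] {V : E → E} {K : NNReal}

/-- Boundedness of V excludes escape in finite time: Picard–Lindelöf applies on every interval of
radius N + 1, and by uniqueness the solutions glue. -/
theorem exists_global_solution [CompleteSpace E] (hK : LipschitzWith K V) {L : NNReal}
    (hL : ∀ x, ‖V x‖ ≤ L) (x : E) : ∃ γ : ℝ → E, γ 0 = x ∧ ∀ t, HasDerivAt γ (V (γ t)) t := by
  have hloc : ∀ N : ℕ, ∃ γ : ℝ → E, γ 0 = x ∧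
      ∀ t ∈ Ioo (-(N + 1) : ℝ) (N + 1), HasDerivAt γ (V (γ t)) t := by
    intro N
    have hN : (0 : ℝ) ∈ Icc (-(N + 1) : ℝ) (N + 1) :=
      ⟨by have : (0 : ℝ) ≤ N := N.cast_nonneg
          linarith, by positivity⟩
    -- The radius L(N + 1) is the furthest a curve of speed at most L can travel in time N + 1.
    have hP : IsPicardLindelof (fun _ => V) (⟨0, hN⟩ : Icc (-(N + 1) : ℝ) (N + 1)) x
        (L * (N + 1)) 0 L K :=
      IsPicardLindelof.of_time_independent (fun y _ => hL y) hK.lipschitzOnWith (by simp)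
    obtain ⟨γ, h0, hγ⟩ := hP.exists_eq_forall_mem_Icc_hasDerivWithinAt₀
    exact ⟨γ, h0, fun t ht => (hγ t (Ioo_subset_Icc_self ht)).hasDerivAt (Icc_mem_nhds ht.1 ht.2)⟩
  choose γ h0 hγ using hloc
  have hcompat : ∀ N M : ℕ, N ≤ M → EqOn (γ N) (γ M) (Ioo (-(N + 1) : ℝ) (N + 1)) := by
    intro N M hNM
    have hNM' : (N : ℝ) ≤ M := by exact_mod_cast hNM
    have h0N : (0 : ℝ) ≤ N := N.cast_nonneg
    refine ODE_solution_unique_of_mem_Ioo (v := fun _ => V) (s := fun _ => univ) (K := K) (t₀ := 0)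
      (fun t _ => hK.lipschitzOnWith) ⟨by linarith, by positivity⟩
      (fun t ht => ⟨hγ N t ht, mem_univ _⟩)
      (fun t ht => ⟨hγ M t ⟨by linarith [ht.1], by linarith [ht.2]⟩, mem_univ _⟩) ?_
    rw [h0, h0]
  -- The glued curve uses at time t the solution of index ⌈|t|⌉; the extra 1 in its interval keeps t
  -- strictly inside.
  have hEq : ∀ N : ℕ, EqOn (fun t => γ ⌈|t|⌉₊ t) (γ N) (Ioo (-(N : ℝ)) N) := by
    intro N t ht
    have h1 : |t| < N := abs_lt.2 ht
    refine hcompat _ _ (Nat.ceil_le.2 h1.le) ?_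
    rw [mem_Ioo, ← abs_lt]
    linarith [Nat.le_ceil |t|]
  refine ⟨fun t => γ ⌈|t|⌉₊ t, by simpa using h0 0, fun t => ?_⟩
  obtain ⟨N, hN⟩ := exists_nat_gt |t|
  have ht : t ∈ Ioo (-(N : ℝ)) N := abs_lt.1 hN
  have hev : (fun t => γ ⌈|t|⌉₊ t) =ᶠ[nhds t] γ N :=
    Filter.eventuallyEq_of_mem (Ioo_mem_nhds ht.1 ht.2) (hEq N)
  have hd := hγ N t ⟨by linarith [ht.1], by linarith [ht.2]⟩
  have he := hEq N ht
  simp only at he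
  have hd' : HasDerivAt (γ N) (V (γ ⌈|t|⌉₊ t)) t := by rwa [he]
  exact hd'.congr_of_eventuallyEq hev

theorem solution_unique (hK : LipschitzWith K V) {γ η : ℝ → E}
    (hγ : ∀ t, HasDerivAt γ (V (γ t)) t) (hη : ∀ t, HasDerivAt η (V (η t)) t) {t₀ : ℝ}
    (h : γ t₀ = η t₀) : γ = η :=
  ODE_solution_unique_univ (v := fun _ => V) (s := fun _ => univ) (K := K)
    (fun _ => hK.lipschitzOnWith) (fun t => ⟨hγ t, mem_univ _⟩) (fun t => ⟨hη t, mem_univ _⟩) h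

/-- `φ` is the global flow of the vector field `V`. -/
structure IsFlow (V : E → E) (φ : ℝ → E → E) : Prop where
  zero : ∀ x, φ 0 x = x
  hasDerivAt : ∀ x t, HasDerivAt (fun s => φ s x) (V (φ t x)) t

theorem IsFlow.add {φ : ℝ → E → E} (hφ : IsFlow V φ) (hK : LipschitzWith K V) (s t : ℝ) (x : E) :
    φ (s + t) x = φ s (φ t x) := by
  have := solution_unique hK (γ := fun r => φ (r + t) x) (η := fun r => φ r (φ t x)) (t₀ := 0)
    (fun r => (hφ.hasDerivAt x (r + t)).comp_add_const r t) (fun r => hφ.hasDerivAt _ r)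
    (by simp [hφ.zero])
  exact congrFun this s

section SmoothDependence

open ContinuousMap

universe u
variable {E : Type u} [NormedAddCommGroup E] [NormedSpace ℝ E] {V : E → E} {K : NNReal}

/-- The rescaled trajectory `s ↦ φ (t s) x` on the unit interval. -/
noncomputable def IsFlow.path {φ : ℝ → E → E} (hφ : IsFlow V φ) (p : ℝ × E) :
    C(unitInterval, E) :=
  ⟨fun s => φ (p.1 * s) p.2, by
    have : Continuous fun s => φ s p.2 :=
      continuous_iff_continuousAt.2 fun t => (hφ.hasDerivAt p.2 t).continuousAt
    exact this.comp (by fun_prop)⟩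

/-- The defect of the rescaled integral equation `α = x + t ∫ V ∘ α`. -/
noncomputable def integralDefect (hV : Continuous V) (q : (ℝ × E) × C(unitInterval, E)) :
    C(unitInterval, E) :=
  q.2 - ContinuousMap.const _ q.1.2 - q.1.1 • primitive E ((⟨V, hV⟩ : C(E, E)).comp q.2)

/-- Rescaling time to s ∈ [0, 1] puts all trajectories in one Banach space, with t and x as
parameters; this is the fundamental theorem of calculus there. -/
theorem integralDefect_path [CompleteSpace E] {φ : ℝ → E → E} (hφ : IsFlow V φ) (hV : Continuous V)
    (p : ℝ × E) : integralDefect hV (p, hφ.path p) = 0 := by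
  ext s
  have hd : ∀ r : ℝ, HasDerivAt (fun r => φ (p.1 * r) p.2) (p.1 • V (φ (p.1 * r) p.2)) r := by
    intro r
    have := (hφ.hasDerivAt p.2 (p.1 * r)).scomp r ((hasDerivAt_id r).const_mul p.1)
    rw [mul_one] at this
    exact this
  have hc : Continuous fun r => φ (p.1 * r) p.2 :=
    continuous_iff_continuousAt.2 fun r => (hd r).continuousAt
  have hint := intervalIntegral.integral_eq_sub_of_hasDerivAt (a := 0) (b := s)
    (fun r _ => hd r) ((hV.comp hc).const_smul p.1 |>.intervalIntegrable _ _)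
  have hcongr : ∫ r in (0 : ℝ)..s, V (φ (p.1 * (projIcc 0 1 zero_le_one r : unitInterval)) p.2)
      = ∫ r in (0 : ℝ)..s, V (φ (p.1 * r) p.2) := by
    refine intervalIntegral.integral_congr fun r hr => ?_
    rw [uIcc_of_le s.2.1] at hr
    rw [projIcc_of_mem zero_le_one ⟨hr.1, hr.2.trans s.2.2⟩]
  rw [intervalIntegral.integral_smul] at hint
  simp only [integralDefect, IsFlow.path, ContinuousMap.sub_apply, ContinuousMap.coe_mk,
    ContinuousMap.const_apply, ContinuousMap.smul_apply, primitive_apply, ContinuousMap.comp_apply,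
    ContinuousMap.zero_apply]
  rw [hcongr, hint]
  simp [hφ.zero]

/-- For |t| K < 1 the integral term is a contraction in α. Comparing equal defects, rather than
zeros, suits the level-set form of the implicit function theorem. -/
theorem eq_of_integralDefect_eq (hK : LipschitzWith K V) {p : ℝ × E} (hp : |p.1| * K < 1)
    {α β : C(unitInterval, E)}
    (h : integralDefect hK.continuous (p, α) = integralDefect hK.continuous (p, β)) : α = β := by
  set S : C(unitInterval, E) → C(unitInterval, E) :=
    fun α => (⟨V, hK.continuous⟩ : C(E, E)).comp α
  have h1 : α - β = p.1 • primitive E (S α - S β) := by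
    simp only [integralDefect] at h
    rw [map_sub, smul_sub]
    rw [← sub_eq_zero] at h ⊢
    rw [← h]
    abel
  have h2 : ‖S α - S β‖ ≤ K * ‖α - β‖ := by
    rw [ContinuousMap.norm_le _ (by positivity)]
    intro s
    exact (hK.norm_sub_le _ _).trans
      (mul_le_mul_of_nonneg_left ((α - β).norm_coe_le_norm s) K.2)
  have h3 : ‖α - β‖ ≤ |p.1| * K * ‖α - β‖ := by
    calc ‖α - β‖ = |p.1| * ‖primitive E (S α - S β)‖ := by
          conv_lhs => rw [h1]
          rw [norm_smul, Real.norm_eq_abs]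
      _ ≤ |p.1| * (1 * ‖S α - S β‖) := by
          gcongr
          exact (primitive E).le_of_opNorm_le norm_primitive_le _
      _ ≤ |p.1| * (1 * (K * ‖α - β‖)) := by gcongr
      _ = _ := by ring
  have h4 : ‖α - β‖ ≤ 0 := by
    by_contra! hpos
    nlinarith
  exact sub_eq_zero.1 (norm_le_zero_iff.1 h4)

theorem contDiff_integralDefect (hV : ContDiff ℝ ∞ V) :
    ContDiff ℝ ∞ (integralDefect (E := E) hV.continuous) := by
  have hc : ContDiff ℝ ∞ fun x : E => ContinuousMap.const unitInterval x :=
    (ContinuousLinearMap.const ℝ unitInterval : E →L[ℝ] C(unitInterval, E)).contDiff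
  have hS := contDiff_comp_left (X := unitInterval) hV
  exact (contDiff_snd.sub (hc.comp (contDiff_snd.comp contDiff_fst))).sub
    ((contDiff_fst.comp contDiff_fst).smul ((primitive E).contDiff.comp (hS.comp contDiff_snd)))

/-- The partial derivative in α is 1 - T with ‖T‖ ≤ |t| K < 1, invertible by the Neumann series. -/
theorem isInvertible_fderiv_integralDefect [CompleteSpace E] (hV : ContDiff ℝ ∞ V)
    (hK : LipschitzWith K V) {q : (ℝ × E) × C(unitInterval, E)} (hq : |q.1.1| * K < 1) :
    (fderiv ℝ (integralDefect hV.continuous) q ∘L .inr ℝ (ℝ × E) C(unitInterval, E)).IsInvertible := by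
  obtain ⟨p, α⟩ := q
  have hdiff := (contDiff_integralDefect hV).differentiable (by simp) (p, α)
  set T : C(unitInterval, E) →L[ℝ] C(unitInterval, E) :=
    p.1 • (primitive E ∘L pointwiseApply unitInterval E E
      ((⟨fderiv ℝ V, hV.continuous_fderiv (by simp)⟩ : C(E, E →L[ℝ] E)).comp α)) with hT
  have h1 : HasFDerivAt (fun β => integralDefect hV.continuous (p, β))
      (fderiv ℝ (integralDefect hV.continuous) (p, α) ∘L .inr ℝ (ℝ × E) C(unitInterval, E)) α :=
    hdiff.hasFDerivAt.comp α (hasFDerivAt_prodMk_right p α)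
  have h2 : HasFDerivAt (fun β => integralDefect hV.continuous (p, β))
      (1 - T) α := by
    have hS := hasFDerivAt_comp_left (X := unitInterval)
      (fun x => (hV.differentiable (by simp) x).hasFDerivAt) (hV.continuous_fderiv (by simp)) α
    exact ((hasFDerivAt_id (𝕜 := ℝ) α).sub_const (ContinuousMap.const _ p.2)).sub
      (((primitive E).hasFDerivAt.comp α hS).const_smul p.1)
  rw [h1.unique h2]
  have hTn : ‖T‖ < 1 := by
    refine lt_of_le_of_lt (ContinuousLinearMap.opNorm_le_bound _ (by positivity) fun h => ?_) hq
    simp only [hT, _root_.smul_apply, ContinuousLinearMap.comp_apply, norm_smul,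
      Real.norm_eq_abs, mul_assoc]
    gcongr
    refine ((primitive E).le_of_opNorm_le norm_primitive_le _).trans ?_
    rw [one_mul, ContinuousMap.norm_le _ (by positivity)]
    intro s
    rw [pointwiseApply_apply]
    refine (ContinuousLinearMap.le_opNorm _ _).trans ?_
    gcongr
    · exact norm_fderiv_le_of_lipschitz ℝ hK
    · exact h.norm_coe_le_norm s
  obtain ⟨e, he⟩ := isUnit_one_sub_of_norm_lt_one
    (R := C(unitInterval, E) →L[ℝ] C(unitInterval, E)) hTn
  exact ⟨ContinuousLinearEquiv.unitsEquiv ℝ _ e, by rw [← he]; rfl⟩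

/-- The implicit function theorem yields a smooth family of solutions of the integral equation, and
uniqueness identifies it with the true trajectories. Evaluation at s = 1 recovers the flow. -/
theorem IsFlow.contDiffAt_of_small [CompleteSpace E] {φ : ℝ → E → E} (hφ : IsFlow V φ)
    (hV : ContDiff ℝ ∞ V) (hK : LipschitzWith K V) {t : ℝ} (ht : |t| * K < 1) (x : E) :
    ContDiffAt ℝ ∞ (fun p : ℝ × E => φ p.1 p.2) (t, x) := by
  set u : (ℝ × E) × C(unitInterval, E) := ((t, x), hφ.path (t, x))
  have cdf := (contDiff_integralDefect hV).contDiffAt (x := u)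
  have inv := isInvertible_fderiv_integralDefect hV hK (q := u) ht
  have hψ := cdf.contDiffAt_implicitFunction (by simp) inv
  have hev := cdf.eventually_apply_implicitFunction (by simp) inv
  have hopen : ∀ᶠ p : ℝ × E in nhds (t, x), |p.1| * K < 1 :=
    (isOpen_lt (by fun_prop) continuous_const).mem_nhds ht
  have hpath : hφ.path =ᶠ[nhds (t, x)] cdf.implicitFunction (by simp) inv := by
    filter_upwards [hev, hopen] with p hp hp1
    refine eq_of_integralDefect_eq hK hp1 ?_
    rw [hp, integralDefect_path hφ, integralDefect_path hφ]
  have hsm : ContDiffAt ℝ ∞ hφ.path (t, x) := hψ.congr_of_eventuallyEq hpath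
  have := (ContinuousMap.evalCLM ℝ (1 : unitInterval) :
    C(unitInterval, E) →L[ℝ] E).contDiff.contDiffAt.comp (t, x) hsm
  refine this.congr_of_eventuallyEq (Filter.Eventually.of_forall fun p => ?_)
  simp [IsFlow.path]

/-- The flow of a smooth Lipschitz vector field is jointly smooth. -/
theorem IsFlow.contDiff [CompleteSpace E] {φ : ℝ → E → E} (hφ : IsFlow V φ)
    (hV : ContDiff ℝ ∞ V) (hK : LipschitzWith K V) :
    ContDiff ℝ ∞ (fun p : ℝ × E => φ p.1 p.2) := by
  -- Smallness of the time is removed by doubling: the flow for time t is the flow for time t/2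
  -- applied twice.
  have key : ∀ (N : ℕ) (t : ℝ) (x : E), |t| * K < 2 ^ N →
      ContDiffAt ℝ ∞ (fun p : ℝ × E => φ p.1 p.2) (t, x) := by
    intro N
    induction N with
    | zero => exact fun t x ht => hφ.contDiffAt_of_small hV hK (by simpa using ht) x
    | succ N ih =>
      intro t x ht
      have ht' : |t / 2| * K < 2 ^ N := by
        rw [abs_div, abs_two]
        rw [pow_succ] at ht
        linarith
      have h1 : ContDiffAt ℝ ∞ (fun p : ℝ × E => φ (p.1 / 2) p.2) (t, x) :=
        (ih (t / 2) x ht').comp (t, x)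
          (f := fun p : ℝ × E => (p.1 / 2, p.2)) (by fun_prop)
      have h2 : ContDiffAt ℝ ∞ (fun p : ℝ × E => φ (p.1 / 2) (φ (p.1 / 2) p.2)) (t, x) :=
        (ih (t / 2) (φ (t / 2) x) ht').comp (t, x)
          (f := fun p : ℝ × E => (p.1 / 2, φ (p.1 / 2) p.2))
          (ContDiffAt.prodMk (by fun_prop) h1)
      refine h2.congr_of_eventuallyEq (Filter.Eventually.of_forall fun p => ?_)
      simp only
      rw [← hφ.add hK, add_halves]
  rw [contDiff_iff_contDiffAt]
  rintro ⟨t, x⟩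
  obtain ⟨N, hN⟩ := pow_unbounded_of_one_lt (|t| * K : ℝ) one_lt_two
  exact key N t x hN

theorem exists_isFlow [CompleteSpace E] (hK : LipschitzWith K V) {L : NNReal}
    (hL : ∀ x, ‖V x‖ ≤ L) : ∃ φ : ℝ → E → E, IsFlow V φ := by
  choose γ h0 hγ using exists_global_solution hK hL
  exact ⟨fun t x => γ x t, h0, hγ⟩

end SmoothDependence

end ODE

/-! ### Flat extension across the unit sphere, and functions compared on the exterior of the ball -/

section Extension

variable {E F : Type*} [NormedAddCommGroup E] [NormedSpace ℝ E] [NormedAddCommGroup F]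
  [NormedSpace ℝ F]

/-- A function that is smooth on a closed set and flat on its frontier extends smoothly by zero. -/
theorem ContDiffOn.contDiff_indicator {s : Set E} {f : E → F} (hs : IsClosed s)
    (hu : UniqueDiffOn ℝ s) (hf : ContDiffOn ℝ ∞ f s)
    (h : ∀ x ∈ frontier s, ∀ k : ℕ, iteratedFDerivWithin ℝ k f s x = 0) :
    ContDiff ℝ ∞ (s.indicator f) := by
  classical
  have hT := hf.ftaylorSeriesWithin hu
  have hd : ∀ (k : ℕ) (x : E), HasFDerivAt (s.indicator (iteratedFDerivWithin ℝ k f s))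
      (s.indicator (iteratedFDerivWithin ℝ (k + 1) f s) x).curryLeft x := by
    intro k x
    by_cases hx : x ∈ s
    · have hin : HasFDerivWithinAt (s.indicator (iteratedFDerivWithin ℝ k f s))
          (s.indicator (iteratedFDerivWithin ℝ (k + 1) f s) x).curryLeft s x := by
        rw [indicator_of_mem hx]
        exact (hT.fderivWithin k (mod_cast ENat.natCast_lt_top k) x hx).congr
          (fun y hy => indicator_of_mem hy _) (indicator_of_mem hx _)
      -- At a frontier point the derivative is taken separately within s and within its complement.
      -- Both agree because all Taylor coefficients vanish there.
      by_cases hfr : x ∈ frontier s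
      · have hout : HasFDerivWithinAt (s.indicator (iteratedFDerivWithin ℝ k f s))
            (s.indicator (iteratedFDerivWithin ℝ (k + 1) f s) x).curryLeft sᶜ x := by
          rw [indicator_of_mem hx, h x hfr]
          refine (hasFDerivWithinAt_const (0 : E [×k]→L[ℝ] F) x sᶜ).congr
            (fun y hy => indicator_of_notMem hy _) ?_
          rw [indicator_of_mem hx, h x hfr]
        simpa using hin.union hout
      · have hint : x ∈ interior s := by
          by_contra hc
          exact hfr ⟨subset_closure hx, hc⟩
        exact hin.hasFDerivAt (mem_interior_iff_mem_nhds.1 hint)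
    · rw [indicator_of_notMem hx]
      refine (hasFDerivAt_const (0 : E [×k]→L[ℝ] F) x).congr_of_eventuallyEq ?_
      filter_upwards [hs.isOpen_compl.mem_nhds hx] with y hy
      exact indicator_of_notMem hy _
  have hS : HasFTaylorSeriesUpTo ∞ (s.indicator f)
      (fun x k => s.indicator (iteratedFDerivWithin ℝ k f s) x) :=
    { zero_eq := fun x => by
        by_cases hx : x ∈ s <;> simp [hx]
      fderiv := fun k _ x => hd k x
      cont := fun k _ => continuous_iff_continuousAt.2 fun x => (hd k x).continuousAt }
  exact hS.contDiff

theorem uniqueDiffOn_closedBall_zero_one : UniqueDiffOn ℝ (closedBall (0 : E) 1) :=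
  uniqueDiffOn_convex (convex_closedBall 0 1) (by
    rw [interior_closedBall _ one_ne_zero]
    exact nonempty_ball.2 one_pos)

/-- The difference u - ℓ is flat on the sphere, so its extension by zero is smooth; adding ℓ back
gives v. -/
theorem exists_contDiff_extension {u ℓ : E → F} (hu : ContDiffOn ℝ ∞ u (closedBall 0 1))
    (hℓ : ContDiff ℝ ∞ ℓ)
    (h : ∀ x ∈ sphere (0 : E) 1, ∀ k : ℕ,
      iteratedFDerivWithin ℝ k u (closedBall 0 1) x = iteratedFDeriv ℝ k ℓ x) :
    ∃ v : E → F, ContDiff ℝ ∞ v ∧ EqOn v u (closedBall 0 1) ∧ ∀ x, 1 ≤ ‖x‖ → v x = ℓ x := by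
  have hU := uniqueDiffOn_closedBall_zero_one (E := E)
  have hind : ContDiff ℝ ∞ ((closedBall (0 : E) 1).indicator (u - ℓ)) := by
    refine (hu.sub hℓ.contDiffOn).contDiff_indicator isClosed_closedBall hU fun x hx k => ?_
    rw [frontier_closedBall _ one_ne_zero] at hx
    have hxb : x ∈ closedBall (0 : E) 1 := sphere_subset_closedBall hx
    rw [iteratedFDerivWithin_sub_apply ((hu x hxb).of_le (mod_cast le_top))
      (hℓ.contDiffWithinAt.of_le (mod_cast le_top)) hU hxb, h x hx k,
      iteratedFDerivWithin_eq_iteratedFDeriv hU (hℓ.contDiffAt.of_le (mod_cast le_top)) hxb,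
      sub_self]
  refine ⟨fun x => ℓ x + (closedBall (0 : E) 1).indicator (u - ℓ) x, hℓ.add hind,
    fun x hx => by simp [indicator_of_mem hx], fun x hx => ?_⟩
  rcases hx.eq_or_lt with hx | hx
  · have hxs : x ∈ sphere (0 : E) 1 := by simp [← hx]
    have h0 : u x = ℓ x := by
      have := congrArg (fun p => p 0) (h x hxs 0)
      simpa using this
    simp [indicator_of_mem (sphere_subset_closedBall hxs), h0]
  · have hxb : x ∉ closedBall (0 : E) 1 := by simpa using hx
    simp [indicator_of_notMem hxb]

theorem ContDiff.isSymmSndFDerivAt_of_infty {f : E → F} (hf : ContDiff ℝ ∞ f) (x : E) :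
    IsSymmSndFDerivAt ℝ f x :=
  (contDiff_infty.1 hf 2).contDiffAt.isSymmSndFDerivAt (by simp)

theorem setOf_one_le_norm_eq_closure : {x : E | 1 ≤ ‖x‖} = closure (closedBall (0 : E) 1)ᶜ := by
  rw [closure_compl, interior_closedBall _ one_ne_zero]
  ext x
  simp

theorem eq_of_eqOn_compl_closedBall {Y : Type*} [TopologicalSpace Y] [T2Space Y] {f g : E → Y}
    (hf : Continuous f) (hg : Continuous g) (h : EqOn f g (closedBall (0 : E) 1)ᶜ) {x : E}
    (hx : 1 ≤ ‖x‖) : f x = g x := by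
  have hx' : x ∈ closure (closedBall (0 : E) 1)ᶜ := by
    rw [← setOf_one_le_norm_eq_closure]
    exact hx
  exact h.closure hf hg hx'

theorem eventuallyEq_of_eq_of_one_le_norm {E Y : Type*} [NormedAddCommGroup E] {f g : E → Y}
    (h : ∀ x, 1 ≤ ‖x‖ → f x = g x) {x : E}
    (hx : x ∈ (closedBall (0 : E) 1)ᶜ) : f =ᶠ[nhds x] g := by
  filter_upwards [isClosed_closedBall.isOpen_compl.mem_nhds hx] with z hz
  exact h z (le_of_lt (by simpa using hz))

theorem fderiv_eq_of_eqOn_one_le_norm {f g : E → F} (hf : ContDiff ℝ ∞ f) (hg : ContDiff ℝ ∞ g)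
    (h : ∀ x, 1 ≤ ‖x‖ → f x = g x) (x : E) (hx : 1 ≤ ‖x‖) : fderiv ℝ f x = fderiv ℝ g x :=
  eq_of_eqOn_compl_closedBall (hf.continuous_fderiv (by simp)) (hg.continuous_fderiv (by simp))
    (fun _ hy => (eventuallyEq_of_eq_of_one_le_norm h hy).fderiv_eq) hx

theorem iteratedFDeriv_eq_of_eqOn_one_le_norm {f g : E → F} (hf : ContDiff ℝ ∞ f)
    (hg : ContDiff ℝ ∞ g) (h : ∀ x, 1 ≤ ‖x‖ → f x = g x) (k : ℕ) (x : E) (hx : 1 ≤ ‖x‖) :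
    iteratedFDeriv ℝ k f x = iteratedFDeriv ℝ k g x :=
  eq_of_eqOn_compl_closedBall (hf.continuous_iteratedFDeriv (mod_cast le_top))
    (hg.continuous_iteratedFDeriv (mod_cast le_top))
    (fun _ hy => ((eventuallyEq_of_eq_of_one_le_norm h hy).iteratedFDeriv ℝ k).eq_of_nhds) hx

/-- The radial map adding 1 to the norm carries the punctured space, connected in dimension at least
two, onto the exterior of the ball. -/
theorem isPreconnected_compl_closedBall (hE : 1 < Module.rank ℝ E) :
    IsPreconnected (closedBall (0 : E) 1)ᶜ := by
  have h0 : IsPreconnected ({0}ᶜ : Set E) := (isConnected_compl_singleton_of_one_lt_rank hE 0).2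
  have himg : (fun x : E => (1 + ‖x‖⁻¹) • x) '' {0}ᶜ = (closedBall (0 : E) 1)ᶜ := by
    ext y
    simp only [mem_image, mem_compl_iff, mem_singleton_iff, mem_closedBall, dist_zero_right, not_le]
    constructor
    · rintro ⟨x, hx, rfl⟩
      have hpos : 0 < ‖x‖ := norm_pos_iff.2 hx
      rw [norm_smul, Real.norm_of_nonneg (by positivity), add_mul, inv_mul_cancel₀ hpos.ne']
      linarith
    · intro hy
      have hy0 : 0 < ‖y‖ := by linarith
      have hc : 0 < 1 - ‖y‖⁻¹ := by
        have := inv_lt_one_of_one_lt₀ hy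
        linarith
      refine ⟨(1 - ‖y‖⁻¹) • y, ?_, ?_⟩
      · simp only [smul_eq_zero, not_or]
        exact ⟨hc.ne', norm_pos_iff.1 hy0⟩
      · rw [norm_smul, Real.norm_of_nonneg hc.le, smul_smul]
        have hne : ‖y‖ - 1 ≠ 0 := by linarith
        have : (1 + ((1 - ‖y‖⁻¹) * ‖y‖)⁻¹) * (1 - ‖y‖⁻¹) = 1 := by
          rw [sub_mul, inv_mul_cancel₀ hy0.ne', one_mul]
          field_simp
          ring
        rw [this, one_smul]
  rw [← himg]
  refine h0.image _ (ContinuousOn.smul (continuousOn_const.add ?_) continuousOn_id)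
  exact continuousOn_id.norm.inv₀ fun x hx => norm_ne_zero_iff.2 hx

theorem exists_eq_const_of_fderiv_eq_zero (hE : 1 < Module.rank ℝ E) {f : E → ℝ}
    (hf : Differentiable ℝ f) (h : ∀ x, 1 ≤ ‖x‖ → fderiv ℝ f x = 0) :
    ∃ c, ∀ x, 1 ≤ ‖x‖ → f x = c := by
  obtain ⟨c, hc⟩ := isClosed_closedBall.isOpen_compl.exists_is_const_of_fderiv_eq_zero
    (isPreconnected_compl_closedBall hE) hf.differentiableOn
    (fun x hx => h x (by simpa using le_of_lt (by simpa using hx)))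
  exact ⟨c, fun x hx =>
    eq_of_eqOn_compl_closedBall hf.continuous continuous_const (fun y hy => hc y hy) hx⟩

end Extension

/-! ### Uniqueness for smooth fields with no global Lipschitz bound -/

namespace ODE

variable {E : Type*} [NormedAddCommGroup E] [NormedSpace ℝ E] [FiniteDimensional ℝ E]
  {X : E → E} {f g : ℝ → E}

/-- Uniqueness for autonomous smooth equations along a compact interval, with agreement at an
arbitrary time of the interval. -/
theorem eqOn_Icc_of_contDiff (hX : ContDiff ℝ ∞ X) {a b t₀ : ℝ} (ht₀ : t₀ ∈ Icc a b)
    (hf : ∀ t ∈ Icc a b, HasDerivAt f (X (f t)) t) (hg : ∀ t ∈ Icc a b, HasDerivAt g (X (g t)) t)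
    (h : f t₀ = g t₀) : EqOn f g (Icc a b) := by
  have hfc : ContinuousOn f (Icc a b) := fun t ht => (hf t ht).continuousAt.continuousWithinAt
  have hgc : ContinuousOn g (Icc a b) := fun t ht => (hg t ht).continuousAt.continuousWithinAt
  -- Both trajectories over the compact interval stay in one closed ball, on which the smooth field
  -- is Lipschitz.
  obtain ⟨R, hR⟩ := ((isCompact_Icc.image_of_continuousOn hfc).union
    (isCompact_Icc.image_of_continuousOn hgc)).isBounded.subset_closedBall (0 : E)
  have hfR : ∀ t ∈ Icc a b, f t ∈ closedBall (0 : E) R := fun t ht =>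
    hR (Or.inl (mem_image_of_mem f ht))
  have hgR : ∀ t ∈ Icc a b, g t ∈ closedBall (0 : E) R := fun t ht =>
    hR (Or.inr (mem_image_of_mem g ht))
  obtain ⟨K, hK⟩ := (hX.contDiffOn (s := closedBall (0 : E) R)).exists_lipschitzOnWith (by simp)
    (convex_closedBall 0 R) (isCompact_closedBall 0 R)
  have hl : Icc a t₀ ⊆ Icc a b := Icc_subset_Icc_right ht₀.2
  have hr : Icc t₀ b ⊆ Icc a b := Icc_subset_Icc_left ht₀.1
  rw [← Icc_union_Icc_eq_Icc ht₀.1 ht₀.2]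
  refine EqOn.union ?_ ?_
  · exact ODE_solution_unique_of_mem_Icc_left (v := fun _ => X) (s := fun _ => closedBall (0 : E) R)
      (fun _ _ => hK) (hfc.mono hl)
      (fun t ht => (hf t (hl (Ioc_subset_Icc_self ht))).hasDerivWithinAt)
      (fun t ht => hfR t (hl (Ioc_subset_Icc_self ht))) (hgc.mono hl)
      (fun t ht => (hg t (hl (Ioc_subset_Icc_self ht))).hasDerivWithinAt)
      (fun t ht => hgR t (hl (Ioc_subset_Icc_self ht))) h
  · exact ODE_solution_unique_of_mem_Icc_right (v := fun _ => X)
      (s := fun _ => closedBall (0 : E) R)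
      (fun _ _ => hK) (hfc.mono hr)
      (fun t ht => (hf t (hr (Ico_subset_Icc_self ht))).hasDerivWithinAt)
      (fun t ht => hfR t (hr (Ico_subset_Icc_self ht))) (hgc.mono hr)
      (fun t ht => (hg t (hr (Ico_subset_Icc_self ht))).hasDerivWithinAt)
      (fun t ht => hgR t (hr (Ico_subset_Icc_self ht))) h

end ODE

namespace FixedAngle

variable {m : ℕ} {g : Space m → Matrix (Fin (m + 1)) (Fin (m + 1)) ℝ}

/-! ### Metric algebra and the geodesic equation in weak form -/

section Algebra

/-- The derivative of `x ↦ g_x(v, w)` in the direction `z`, for fixed `v` and `w`. -/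
noncomputable def metricDeriv (g : Space m → Matrix (Fin (m + 1)) (Fin (m + 1)) ℝ)
    (x z v w : Space m) : ℝ :=
  ∑ i, ∑ j, ∑ k, partialDeriv i (fun y => g y j k) x * z i * v j * w k

theorem IsSmoothMetric.symm (hg : IsSmoothMetric g) (x : Space m) (j k : Fin (m + 1)) :
    g x j k = g x k j := by
  have := (hg.posDef x).isHermitian.apply j k
  simpa using this.symm

theorem metricInner_comm (hg : IsSmoothMetric g) (x v w : Space m) :
    metricInner g x v w = metricInner g x w v := by
  unfold metricInner
  rw [Finset.sum_comm]
  refine Finset.sum_congr rfl fun j _ => Finset.sum_congr rfl fun k _ => ?_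
  rw [hg.symm x k j]
  ring

theorem metricInner_add_left (x v v' w : Space m) :
    metricInner g x (v + v') w = metricInner g x v w + metricInner g x v' w := by
  simp only [metricInner, PiLp.add_apply, mul_add, add_mul, Finset.sum_add_distrib]

theorem metricInner_add_right (x v w w' : Space m) :
    metricInner g x v (w + w') = metricInner g x v w + metricInner g x v w' := by
  simp only [metricInner, PiLp.add_apply, mul_add, Finset.sum_add_distrib]

theorem metricInner_smul_right (c : ℝ) (x v w : Space m) :
    metricInner g x v (c • w) = c * metricInner g x v w := by
  simp only [metricInner, PiLp.smul_apply, smul_eq_mul, Finset.mul_sum]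
  refine Finset.sum_congr rfl fun j _ => Finset.sum_congr rfl fun k _ => ?_
  ring

/-- The covector `g_x(v, ·)`. -/
noncomputable def flat (g : Space m → Matrix (Fin (m + 1)) (Fin (m + 1)) ℝ) (x v : Space m) :
    Space m →L[ℝ] ℝ :=
  LinearMap.toContinuousLinearMap
    { toFun := metricInner g x v
      map_add' := metricInner_add_right x v
      map_smul' := fun c w => metricInner_smul_right c x v w }

@[simp]
theorem flat_apply (x v w : Space m) : flat g x v w = metricInner g x v w := rfl

theorem metricInner_unitVec_right (x v : Space m) (k : Fin (m + 1)) :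
    metricInner g x v (unitVec k) = ∑ j, g x j k * v j := by
  simp [metricInner, unitVec]

theorem metricInner_eq_dotProduct (x v w : Space m) :
    metricInner g x v w = (v : Fin (m + 1) → ℝ) ⬝ᵥ ((g x).mulVec w) := by
  simp only [metricInner, dotProduct, Matrix.mulVec, Finset.mul_sum]
  refine Finset.sum_congr rfl fun j _ => Finset.sum_congr rfl fun k _ => ?_
  ring

theorem IsSmoothMetric.isUnit_det (hg : IsSmoothMetric g) (x : Space m) : IsUnit (g x).det :=
  isUnit_iff_ne_zero.2 (hg.posDef x).det_pos.ne'

theorem eq_zero_of_metricInner_eq_zero (hg : IsSmoothMetric g) {x v : Space m}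
    (h : ∀ w, metricInner g x v w = 0) : v = 0 := by
  have hz : (g x).mulVec v = 0 := by
    ext k
    have hk := h (unitVec k)
    rw [metricInner_unitVec_right] at hk
    simp only [Matrix.mulVec, dotProduct, Pi.zero_apply]
    rw [← hk]
    exact Finset.sum_congr rfl fun j _ => by rw [hg.symm x k j]
  have hv : (v : Fin (m + 1) → ℝ) = 0 := by
    rw [← Matrix.one_mulVec (v : Fin (m + 1) → ℝ), ← Matrix.nonsing_inv_mul _ (hg.isUnit_det x),
      ← Matrix.mulVec_mulVec, hz, Matrix.mulVec_zero]
  ext i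
  simpa using congrFun hv i

/-- The quadratic form `Γ^k_{ij} v^i v^j` as a vector. -/
noncomputable def christoffelVec (g : Space m → Matrix (Fin (m + 1)) (Fin (m + 1)) ℝ)
    (x v : Space m) : Space m :=
  WithLp.toLp 2 fun k => ∑ i, ∑ j, christoffel g k i j x * v i * v j

/-- Lowering the upper index cancels the inverse metric, so later computations involve only
derivatives of g. -/
theorem sum_metric_mul_christoffel (hg : IsSmoothMetric g) (l i j : Fin (m + 1)) (x : Space m) :
    ∑ k, g x l k * christoffel g k i j x =
      (1 / 2) * (partialDeriv i (fun z => g z j l) x + partialDeriv j (fun z => g z i l) x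
        - partialDeriv l (fun z => g z i j) x) := by
  set c : Fin (m + 1) → ℝ := fun l => partialDeriv i (fun z => g z j l) x
    + partialDeriv j (fun z => g z i l) x - partialDeriv l (fun z => g z i j) x with hc
  have h1 : ∀ k, christoffel g k i j x = (1 / 2) * (((g x)⁻¹).mulVec c) k := fun k => rfl
  have h2 : ∑ k, g x l k * (((g x)⁻¹).mulVec c) k = c l := by
    change (g x).mulVec (((g x)⁻¹).mulVec c) l = c l
    rw [Matrix.mulVec_mulVec, Matrix.mul_nonsing_inv _ (hg.isUnit_det x), Matrix.one_mulVec]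
  simp only [h1]
  change _ = (1 / 2) * c l
  rw [← h2, Finset.mul_sum]
  exact Finset.sum_congr rfl fun k _ => by ring

/-- Of the three terms in the lowered Christoffel symbol, the first two coincide once contracted
with v twice. -/
theorem metricInner_christoffelVec (hg : IsSmoothMetric g) (x v w : Space m) :
    metricInner g x (christoffelVec g x v) w =
      metricDeriv g x v v w - (1 / 2) * metricDeriv g x w v v := by
  have h1 : metricInner g x (christoffelVec g x v) w =
      ∑ l, w l * ∑ i, ∑ j, (∑ k, g x l k * christoffel g k i j x) * v i * v j := by
    rw [metricInner_comm hg]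
    simp only [metricInner, christoffelVec, Finset.sum_mul, Finset.mul_sum]
    refine Finset.sum_congr rfl fun l _ => ?_
    rw [Finset.sum_comm]
    refine Finset.sum_congr rfl fun i _ => ?_
    rw [Finset.sum_comm]
    refine Finset.sum_congr rfl fun j _ => Finset.sum_congr rfl fun k _ => ?_
    ring
  have h2 : ∑ l, w l * ∑ i, ∑ j, partialDeriv i (fun z => g z j l) x * v i * v j
      = metricDeriv g x v v w := by
    simp only [metricDeriv, Finset.mul_sum]
    rw [Finset.sum_comm]
    refine Finset.sum_congr rfl fun i _ => ?_
    rw [Finset.sum_comm]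
    refine Finset.sum_congr rfl fun j _ => Finset.sum_congr rfl fun k _ => ?_
    ring
  have h3 : ∑ l, w l * ∑ i, ∑ j, partialDeriv j (fun z => g z i l) x * v i * v j
      = metricDeriv g x v v w := by
    rw [← h2]
    refine Finset.sum_congr rfl fun l _ => ?_
    rw [Finset.sum_comm]
    congr 1
    refine Finset.sum_congr rfl fun i _ => Finset.sum_congr rfl fun j _ => ?_
    ring
  have h4 : ∑ l, w l * ∑ i, ∑ j, partialDeriv l (fun z => g z i j) x * v i * v j
      = metricDeriv g x w v v := by
    simp only [metricDeriv, Finset.mul_sum]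
    refine Finset.sum_congr rfl fun i _ => Finset.sum_congr rfl fun j _ =>
      Finset.sum_congr rfl fun k _ => ?_
    ring
  have h5 : metricInner g x (christoffelVec g x v) w =
      (1 / 2) * (metricDeriv g x v v w + metricDeriv g x v v w - metricDeriv g x w v v) := by
    rw [h1]
    simp only [sum_metric_mul_christoffel hg]
    conv_rhs => rw [← h4]; enter [2, 1, 2]; rw [← h3]
    rw [← h2]
    simp only [← Finset.sum_add_distrib, ← Finset.sum_sub_distrib, Finset.mul_sum]
    refine Finset.sum_congr rfl fun l _ => Finset.sum_congr rfl fun i _ =>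
      Finset.sum_congr rfl fun j _ => ?_
    ring
  rw [h5]
  ring

/-- The geodesic equation at a point, tested against all vectors. -/
theorem add_christoffelVec_eq_zero_iff (hg : IsSmoothMetric g) {x v a : Space m} :
    a + christoffelVec g x v = 0 ↔ ∀ w,
      metricInner g x a w + metricDeriv g x v v w = (1 / 2) * metricDeriv g x w v v := by
  constructor
  · intro h w
    have h1 : metricInner g x (a + christoffelVec g x v) w = 0 := by
      rw [h]
      simp [metricInner]
    rw [metricInner_add_left, metricInner_christoffelVec hg] at h1
    linarith
  · intro h
    refine eq_zero_of_metricInner_eq_zero hg (x := x) fun w => ?_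
    rw [metricInner_add_left, metricInner_christoffelVec hg]
    linarith [h w]

end Algebra

/-! ### Product rule, geodesic spray, and straight geodesics where the metric is Euclidean -/

section Calculus

theorem sum_smul_unitVec (z : Space m) : ∑ i, z i • (unitVec i : Space m) = z := by
  ext k
  simp [unitVec, Pi.single_apply]

theorem fderiv_eq_sum_partialDeriv (f : Space m → ℝ) (x z : Space m) :
    fderiv ℝ f x z = ∑ i, partialDeriv i f x * z i := by
  conv_lhs => rw [← sum_smul_unitVec z, map_sum]
  refine Finset.sum_congr rfl fun i _ => ?_
  rw [map_smul, smul_eq_mul, mul_comm]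
  rfl

theorem _root_.HasDerivAt.euclidean_apply {v : ℝ → Space m} {a : Space m} {t : ℝ}
    (h : HasDerivAt v a t) (k : Fin (m + 1)) : HasDerivAt (fun s => v s k) (a k) t :=
  (EuclideanSpace.proj k : Space m →L[ℝ] ℝ).hasFDerivAt.comp_hasDerivAt t h

/-- Product rule for the inner product of two vector fields along a curve. -/
theorem hasDerivAt_metricInner (hg : IsSmoothMetric g) {γ v w : ℝ → Space m} {z a b : Space m}
    {t : ℝ} (hγ : HasDerivAt γ z t) (hv : HasDerivAt v a t) (hw : HasDerivAt w b t) :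
    HasDerivAt (fun s => metricInner g (γ s) (v s) (w s))
      (metricDeriv g (γ t) z (v t) (w t) + metricInner g (γ t) a (w t)
        + metricInner g (γ t) (v t) b) t := by
  have hG : ∀ j k, HasDerivAt (fun s => g (γ s) j k)
      (∑ i, partialDeriv i (fun y => g y j k) (γ t) * z i) t := by
    intro j k
    rw [← fderiv_eq_sum_partialDeriv]
    exact ((hg.smooth j k).differentiable (by simp) (γ t)).hasFDerivAt.comp_hasDerivAt t hγ
  have hsum := HasDerivAt.fun_sum (u := Finset.univ) fun j _ =>
    HasDerivAt.fun_sum (u := Finset.univ) fun k _ =>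
      ((hG j k).mul (hv.euclidean_apply j)).mul (hw.euclidean_apply k)
  refine hsum.congr_deriv ?_
  have hD : metricDeriv g (γ t) z (v t) (w t) = ∑ j, ∑ k,
      (∑ i, partialDeriv i (fun y => g y j k) (γ t) * z i) * v t j * w t k := by
    simp only [metricDeriv, Finset.sum_mul]
    rw [Finset.sum_comm]
    exact Finset.sum_congr rfl fun j _ => Finset.sum_comm
  rw [hD]
  simp only [metricInner, ← Finset.sum_add_distrib]
  refine Finset.sum_congr rfl fun j _ => Finset.sum_congr rfl fun k _ => ?_
  simp only [Pi.mul_apply]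
  ring

theorem isGeodesic_iff {γ : ℝ → Space m} :
    IsGeodesic g γ ↔ ContDiff ℝ ∞ γ ∧
      ∀ t, deriv (deriv γ) t + christoffelVec g (γ t) (deriv γ t) = 0 := by
  refine and_congr_right fun _ => forall_congr' fun t => ⟨fun h => ?_, fun h k => ?_⟩
  · ext k
    simpa [christoffelVec] using h k
  · have := congrArg (fun z : Space m => z k) h
    simpa [christoffelVec] using this

theorem contDiff_deriv {γ : ℝ → Space m} (h : ContDiff ℝ ∞ γ) : ContDiff ℝ ∞ (deriv γ) :=
  ((contDiff_succ_iff_deriv (n := ∞)).1 h).2.2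

theorem contDiff_partialDeriv {f : Space m → ℝ} (hf : ContDiff ℝ ∞ f) (i : Fin (m + 1)) :
    ContDiff ℝ ∞ (partialDeriv i f) :=
  (hf.fderiv_right (m := ∞) (by simp)).clm_apply contDiff_const

theorem IsSmoothMetric.contDiff_inv (hg : IsSmoothMetric g) (j k : Fin (m + 1)) :
    ContDiff ℝ ∞ fun x => (g x)⁻¹ j k := by
  have hdet : ∀ A : Space m → Matrix (Fin (m + 1)) (Fin (m + 1)) ℝ,
      (∀ j k, ContDiff ℝ ∞ fun x => A x j k) → ContDiff ℝ ∞ fun x => (A x).det := by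
    intro A hA
    simp only [Matrix.det_apply']
    exact ContDiff.sum fun σ _ => contDiff_const.mul (contDiff_prod fun i _ => hA _ _)
  have hadj : ContDiff ℝ ∞ fun x => (g x).adjugate j k := by
    simp only [Matrix.adjugate_apply]
    refine hdet _ fun a b => ?_
    by_cases h : a = k
    · subst h
      simp only [Matrix.updateRow_self]
      exact contDiff_const
    · simp only [Matrix.updateRow_ne h]
      exact hg.smooth a b
  have hinv : (fun x => (g x)⁻¹ j k) = fun x => ((g x).det)⁻¹ * (g x).adjugate j k := by
    ext x
    rw [Matrix.inv_def, Ring.inverse_eq_inv']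
    simp
  rw [hinv]
  exact ((hdet g hg.smooth).inv fun x => (hg.posDef x).det_pos.ne').mul hadj

theorem contDiff_christoffel (hg : IsSmoothMetric g) (k i j : Fin (m + 1)) :
    ContDiff ℝ ∞ (christoffel g k i j) := by
  unfold christoffel
  exact contDiff_const.mul (ContDiff.sum fun l _ => (hg.contDiff_inv k l).mul
    (((contDiff_partialDeriv (hg.smooth j l) i).add (contDiff_partialDeriv (hg.smooth i l) j)).sub
      (contDiff_partialDeriv (hg.smooth i j) l)))

theorem contDiff_christoffelVec (hg : IsSmoothMetric g) :
    ContDiff ℝ ∞ fun p : Space m × Space m => christoffelVec g p.1 p.2 := by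
  rw [contDiff_euclidean]
  intro k
  simp only [christoffelVec]
  have hp : ∀ i, ContDiff ℝ ∞ fun p : Space m × Space m => p.2 i := fun i =>
    (EuclideanSpace.proj i : Space m →L[ℝ] ℝ).contDiff.comp contDiff_snd
  exact ContDiff.sum fun i _ => ContDiff.sum fun j _ =>
    (((contDiff_christoffel hg k i j).comp contDiff_fst).mul (hp i)).mul (hp j)

/-- The geodesic spray. -/
noncomputable def spray (g : Space m → Matrix (Fin (m + 1)) (Fin (m + 1)) ℝ)
    (p : Space m × Space m) : Space m × Space m :=
  (p.2, -christoffelVec g p.1 p.2)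

theorem contDiff_spray (hg : IsSmoothMetric g) : ContDiff ℝ ∞ (spray g) :=
  contDiff_snd.prodMk (contDiff_christoffelVec hg).neg

theorem IsGeodesic.hasDerivAt {γ : ℝ → Space m} (h : IsGeodesic g γ) (t : ℝ) :
    HasDerivAt γ (deriv γ t) t :=
  (h.1.differentiable (by simp) t).hasDerivAt

theorem IsGeodesic.hasDerivAt_deriv {γ : ℝ → Space m} (h : IsGeodesic g γ) (t : ℝ) :
    HasDerivAt (deriv γ) (deriv (deriv γ) t) t :=
  ((contDiff_deriv h.1).differentiable (by simp) t).hasDerivAt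

theorem IsGeodesic.hasDerivAt_spray {γ : ℝ → Space m} (h : IsGeodesic g γ) (t : ℝ) :
    HasDerivAt (fun s => (γ s, deriv γ s)) (spray g (γ t, deriv γ t)) t := by
  refine ((h.hasDerivAt t).prodMk (h.hasDerivAt_deriv t)).congr_deriv ?_
  rw [spray, ← eq_neg_of_add_eq_zero_left ((isGeodesic_iff.1 h).2 t)]

/-- Geodesics are determined by their initial data. -/
theorem IsGeodesic.eq (hg : IsSmoothMetric g) {γ η : ℝ → Space m} (hγ : IsGeodesic g γ)
    (hη : IsGeodesic g η) {t₀ : ℝ} (h : γ t₀ = η t₀) (h' : deriv γ t₀ = deriv η t₀) : γ = η := by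
  ext1 t
  have := ODE.eqOn_Icc_of_contDiff (contDiff_spray hg) (a := min t t₀) (b := max t t₀) (t₀ := t₀)
    ⟨min_le_right _ _, le_max_right _ _⟩ (fun s _ => hγ.hasDerivAt_spray s)
    (fun s _ => hη.hasDerivAt_spray s) (by rw [h, h'])
    (show t ∈ Icc (min t t₀) (max t t₀) from ⟨min_le_left _ _, le_max_left _ _⟩)
  exact congrArg Prod.fst this

theorem christoffelVec_eq_zero (hg : IsSmoothMetric g)
    (hout : ∀ x : Space m, 1 ≤ ‖x‖ → g x = 1) {x : Space m} (hx : 1 ≤ ‖x‖) (v : Space m) :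
    christoffelVec g x v = 0 := by
  have hD : ∀ i j k, partialDeriv i (fun y => g y j k) x = 0 := by
    intro i j k
    rw [partialDeriv, fderiv_eq_of_eqOn_one_le_norm (hg.smooth j k)
      (contDiff_const (c := (1 : Matrix (Fin (m + 1)) (Fin (m + 1)) ℝ) j k))
      (fun y hy => by rw [hout y hy]) x hx]
    simp
  ext k
  simp [christoffelVec, christoffel, hD]

/-- Outside the unit ball geodesics are straight lines. -/
theorem IsGeodesic.deriv_eq_of_line (hg : IsSmoothMetric g)
    (hout : ∀ x : Space m, 1 ≤ ‖x‖ → g x = 1) {γ : ℝ → Space m} (hγ : IsGeodesic g γ) {a b t₀ : ℝ}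
    (ht₀ : t₀ ∈ Icc a b) (hl : ∀ t ∈ Icc a b, 1 ≤ ‖γ t₀ + (t - t₀) • deriv γ t₀‖) :
    ∀ t ∈ Icc a b, γ t = γ t₀ + (t - t₀) • deriv γ t₀ ∧ deriv γ t = deriv γ t₀ := by
  have hline : ∀ t ∈ Icc a b, HasDerivAt
      (fun s => (γ t₀ + (s - t₀) • deriv γ t₀, deriv γ t₀))
      (spray g (γ t₀ + (t - t₀) • deriv γ t₀, deriv γ t₀)) t := by
    intro t ht
    have h1 : HasDerivAt (fun s => γ t₀ + (s - t₀) • deriv γ t₀) (deriv γ t₀) t := by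
      simpa using (((hasDerivAt_id t).sub_const t₀).smul_const (deriv γ t₀)).const_add (γ t₀)
    refine (h1.prodMk (hasDerivAt_const t (deriv γ t₀))).congr_deriv ?_
    rw [spray, christoffelVec_eq_zero hg hout (hl t ht), neg_zero]
  intro t ht
  have := ODE.eqOn_Icc_of_contDiff (contDiff_spray hg) ht₀ (fun s _ => hγ.hasDerivAt_spray s)
    hline (by simp) ht
  exact Prod.ext_iff.1 this

end Calculus

/-- The last coordinate `x_n` as a linear functional. -/
noncomputable def lastCoord (m : ℕ) : Space m →L[ℝ] ℝ := EuclideanSpace.proj (Fin.last m)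

@[simp]
theorem lastCoord_apply (x : Space m) : lastCoord m x = x (Fin.last m) := rfl

@[simp]
theorem unitVec_last_apply : (unitVec (Fin.last m) : Space m) (Fin.last m) = 1 := by
  simp [unitVec]

@[simp]
theorem point_last (x' : EuclideanSpace ℝ (Fin m)) (t : ℝ) : point x' t (Fin.last m) = t := by
  simp [point]

theorem point_eq (x' : EuclideanSpace ℝ (Fin m)) (s t : ℝ) :
    point x' t = point x' s + (t - s) • unitVec (Fin.last m) := by
  ext i
  refine Fin.lastCases ?_ (fun j => ?_) i <;> simp [point, unitVec]

theorem exists_eq_point (x : Space m) :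
    ∃ x' : EuclideanSpace ℝ (Fin m), x = point x' (x (Fin.last m)) := by
  refine ⟨WithLp.toLp 2 fun i => x i.castSucc, ?_⟩
  ext i
  refine Fin.lastCases ?_ (fun j => ?_) i <;> simp [point]

theorem one_le_norm_of_abs_last {x : Space m} (h : 1 ≤ |x (Fin.last m)|) : 1 ≤ ‖x‖ :=
  h.trans (PiLp.norm_apply_le x (Fin.last m))

/-! ### Gradients and the eikonal equation -/

section Gradient

/-- The `g`-gradient of a function. -/
noncomputable def grad (g : Space m → Matrix (Fin (m + 1)) (Fin (m + 1)) ℝ) (f : Space m → ℝ)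
    (x : Space m) : Space m :=
  WithLp.toLp 2 ((g x)⁻¹.mulVec fun j => partialDeriv j f x)

theorem contDiff_grad (hg : IsSmoothMetric g) {f : Space m → ℝ} (hf : ContDiff ℝ ∞ f) :
    ContDiff ℝ ∞ (grad g f) := by
  rw [contDiff_euclidean]
  intro k
  simp only [grad, Matrix.mulVec, dotProduct]
  exact ContDiff.sum fun j _ => (hg.contDiff_inv k j).mul (contDiff_partialDeriv hf j)

theorem metricInner_grad (hg : IsSmoothMetric g) (f : Space m → ℝ) (x w : Space m) :
    metricInner g x (grad g f x) w = fderiv ℝ f x w := by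
  rw [metricInner_comm hg, metricInner_eq_dotProduct, grad]
  change _ ⬝ᵥ (g x).mulVec ((g x)⁻¹.mulVec _) = _
  rw [Matrix.mulVec_mulVec, Matrix.mul_nonsing_inv _ (hg.isUnit_det x), Matrix.one_mulVec,
    fderiv_eq_sum_partialDeriv, dotProduct]
  exact Finset.sum_congr rfl fun i _ => mul_comm _ _

/-- Replacing a covector by its metric dual removes the inverse matrix; it serves both for gradients
and for ∂_{y_n}, known only as the dual of dy_n. -/
theorem covectorNorm_eq (hg : IsSmoothMetric g) {x v : Space m} {ξ : Space m →L[ℝ] ℝ}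
    (h : ∀ w, metricInner g x v w = ξ w) : covectorNorm g x ξ = √(metricInner g x v v) := by
  have h1 : (fun k => ξ (unitVec k)) = (g x).mulVec v := by
    ext k
    rw [← h, metricInner_unitVec_right]
    simp only [Matrix.mulVec, dotProduct]
    exact Finset.sum_congr rfl fun j _ => by rw [hg.symm x k j]
  have h2 : (g x)⁻¹.mulVec (fun k => ξ (unitVec k)) = v := by
    rw [h1, Matrix.mulVec_mulVec, Matrix.nonsing_inv_mul _ (hg.isUnit_det x), Matrix.one_mulVec]
  unfold covectorNorm
  congr 1
  calc ∑ j, ∑ k, (g x)⁻¹ j k * ξ (unitVec j) * ξ (unitVec k)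
      = ∑ j, ξ (unitVec j) * ((g x)⁻¹.mulVec (fun k => ξ (unitVec k))) j := by
        simp only [Matrix.mulVec, dotProduct, Finset.mul_sum]
        exact Finset.sum_congr rfl fun j _ => Finset.sum_congr rfl fun k _ => by ring
    _ = ∑ j, ((g x).mulVec v) j * v j := by
        rw [h2, ← h1]
    _ = metricInner g x v v := by
        rw [metricInner_eq_dotProduct, dotProduct]
        exact Finset.sum_congr rfl fun j _ => mul_comm _ _

theorem metricInner_one {x : Space m} (hx : g x = 1) (v w : Space m) :
    metricInner g x v w = ∑ j, v j * w j := by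
  simp [metricInner, hx, Matrix.one_apply]

theorem metricInner_unitVec_of_eq_one {x : Space m} (hx : g x = 1) (i : Fin (m + 1))
    (w : Space m) : metricInner g x (unitVec i) w = w i := by
  simp [metricInner_one hx, unitVec]

theorem hasDerivAt_add_smul_line (x z : Space m) :
    HasDerivAt (fun s : ℝ => x + s • z) z 0 := by
  simpa using ((hasDerivAt_id (0 : ℝ)).smul_const z).const_add x

theorem hasDerivAt_comp_line {F : Type*} [NormedAddCommGroup F] [NormedSpace ℝ F]
    {f : Space m → F} {x z : Space m} (hf : DifferentiableAt ℝ f x) :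
    HasDerivAt (fun s : ℝ => f (x + s • z)) (fderiv ℝ f x z) 0 := by
  have hf' : HasFDerivAt f (fderiv ℝ f x) (x + (0 : ℝ) • z) := by
    simpa using hf.hasFDerivAt
  exact hf'.comp_hasDerivAt 0 (hasDerivAt_add_smul_line x z)

/-- Integral curves of the gradient of a function with unit gradient are geodesics. -/
theorem isGeodesic_of_hasDerivAt_grad (hg : IsSmoothMetric g) {f : Space m → ℝ}
    (hf : ContDiff ℝ ∞ f) (h1 : ∀ x, metricInner g x (grad g f x) (grad g f x) = 1)
    {γ : ℝ → Space m} (hγ : ContDiff ℝ ∞ γ) (hd : ∀ t, HasDerivAt γ (grad g f (γ t)) t) :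
    IsGeodesic g γ := by
  have hV := contDiff_grad hg hf
  have hVd : Differentiable ℝ (grad g f) := hV.differentiable (by simp)
  have hderiv : deriv γ = fun t => grad g f (γ t) := funext fun t => (hd t).deriv
  refine isGeodesic_iff.2 ⟨hγ, fun t => ?_⟩
  have hderiv2 : deriv (deriv γ) t = fderiv ℝ (grad g f) (γ t) (grad g f (γ t)) := by
    rw [hderiv]
    exact ((hVd (γ t)).hasFDerivAt.comp_hasDerivAt t (hd t)).deriv
  rw [hderiv2, hderiv, add_christoffelVec_eq_zero_iff hg]
  intro w
  beta_reduce
  generalize γ t = x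
  set V := grad g f x with hVdef
  set DV := fderiv ℝ (grad g f) x with hDV
  have hdf : DifferentiableAt ℝ (fderiv ℝ f) x :=
    (hf.fderiv_right (m := ∞) (by simp)).differentiable (by simp) x
  -- Differentiating ⟨∇f, y⟩ = df(y) in the direction z expresses the Hessian of f through the
  -- derivative of ∇f.
  have hA : ∀ z y, metricDeriv g x z V y + metricInner g x (DV z) y
      = fderiv ℝ (fderiv ℝ f) x z y := by
    intro z y
    have e1 := hasDerivAt_metricInner hg (hasDerivAt_add_smul_line x z)
      (hasDerivAt_comp_line (z := z) (hVd x)) (hasDerivAt_const (0 : ℝ) y)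
    have e2 : HasDerivAt (fun s : ℝ => fderiv ℝ f (x + s • z) y)
        (fderiv ℝ (fderiv ℝ f) x z y) 0 := by
      simpa using (hasDerivAt_comp_line (z := z) hdf).clm_apply (hasDerivAt_const (0 : ℝ) y)
    simp only [metricInner_grad hg] at e1
    have := e1.unique e2
    simpa [metricInner, hVdef] using this
  -- Differentiating |∇f|² = 1 in the direction w. With symmetry of the Hessian, this turns `hA V w`
  -- into the weak geodesic equation.
  have hB : metricDeriv g x w V V + 2 * metricInner g x (DV w) V = 0 := by
    have e1 := hasDerivAt_metricInner hg (hasDerivAt_add_smul_line x w)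
      (hasDerivAt_comp_line (z := w) (hVd x)) (hasDerivAt_comp_line (z := w) (hVd x))
    simp only [h1] at e1
    have e2 := e1.unique (hasDerivAt_const (0 : ℝ) (1 : ℝ))
    simp only [zero_smul, add_zero] at e2
    rw [metricInner_comm hg x (grad g f x) _] at e2
    linarith
  have hsymm : fderiv ℝ (fderiv ℝ f) x V w = fderiv ℝ (fderiv ℝ f) x w V :=
    hf.isSymmSndFDerivAt_of_infty x V w
  have hA1 := hA V w
  have hA2 := hA w V
  linarith

end Gradient

/-! ### Functions without critical points in the ball -/

section MaximumPrinciple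

/-- A maximum over the closed ball attained inside would be a critical point, so interior values
stay strictly below the boundary bound. -/
theorem lt_one_of_fderiv_ne_zero {f : Space m → ℝ} (hf : Continuous f)
    (hd : ∀ x ∈ ball (0 : Space m) 1, fderiv ℝ f x ≠ 0)
    (hs : ∀ x ∈ sphere (0 : Space m) 1, f x ≤ 1) {x : Space m} (hx : x ∈ ball (0 : Space m) 1) :
    f x < 1 := by
  obtain ⟨y, hy, hmax⟩ := (isCompact_closedBall (0 : Space m) 1).exists_isMaxOn
    ⟨x, ball_subset_closedBall hx⟩ hf.continuousOn
  have hnot : ∀ z ∈ ball (0 : Space m) 1, ¬ IsMaxOn f (closedBall 0 1) z := by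
    intro z hz hzm
    have hnhds : closedBall (0 : Space m) 1 ∈ nhds z :=
      Filter.mem_of_superset (isOpen_ball.mem_nhds hz) ball_subset_closedBall
    exact hd z hz (hzm.isLocalMax hnhds).fderiv_eq_zero
  have hys : y ∈ sphere (0 : Space m) 1 := by
    rcases (mem_closedBall.1 hy).lt_or_eq with h | h
    · exact absurd hmax (hnot y h)
    · exact h
  by_contra! hge
  refine hnot x hx fun z hz => ?_
  exact (hmax hz).trans ((hs y hys).trans hge)

end MaximumPrinciple

/-! ### From an eikonal solution to the geodesic parametrization -/

section Eikonal

theorem grad_eq_unitVec (hg : IsSmoothMetric g)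
    (hout : ∀ x : Space m, 1 ≤ ‖x‖ → g x = 1) {f : Space m → ℝ} (hf : ContDiff ℝ ∞ f)
    (hfo : ∀ x : Space m, 1 ≤ ‖x‖ → f x = x (Fin.last m)) {x : Space m} (hx : 1 ≤ ‖x‖) :
    grad g f x = unitVec (Fin.last m) := by
  rw [← sub_eq_zero]
  refine eq_zero_of_metricInner_eq_zero hg (x := x) fun w => ?_
  have hd := fderiv_eq_of_eqOn_one_le_norm hf (lastCoord m).contDiff hfo x hx
  have h1 : metricInner g x (grad g f x) w = w (Fin.last m) := by
    rw [metricInner_grad hg, hd]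
    simp
  have h2 : metricInner g x (grad g f x - unitVec (Fin.last m) + unitVec (Fin.last m)) w
      = w (Fin.last m) := by
    rw [sub_add_cancel, h1]
  rw [metricInner_add_left, metricInner_unitVec_of_eq_one (hout x hx)] at h2
  linarith

theorem HasEikonal.exists_global (h : HasEikonal g) (hg : IsSmoothMetric g)
    (hout : ∀ x : Space m, 1 ≤ ‖x‖ → g x = 1) :
    ∃ f : Space m → ℝ, ContDiff ℝ ∞ f ∧ (∀ x, 1 ≤ ‖x‖ → f x = x (Fin.last m)) ∧
      ∀ x, metricInner g x (grad g f x) (grad g f x) = 1 := by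
  obtain ⟨u, hu, hn, hs⟩ := h
  obtain ⟨f, hf, hfu, hfo⟩ := exists_contDiff_extension hu (lastCoord m).contDiff hs
  refine ⟨f, hf, hfo, fun x => ?_⟩
  by_cases hx : 1 ≤ ‖x‖
  · rw [grad_eq_unitVec hg hout hf hfo hx, metricInner_unitVec_of_eq_one (hout x hx),
      unitVec_last_apply]
  · have hxb : x ∈ ball (0 : Space m) 1 := by simpa using hx
    have hfd : fderiv ℝ f x = fderiv ℝ u x := by
      refine Filter.EventuallyEq.fderiv_eq ?_
      filter_upwards [isOpen_ball.mem_nhds hxb] with y hy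
      exact hfu (ball_subset_closedBall hy)
    have := hn x hxb
    rw [← hfd, covectorNorm_eq hg (metricInner_grad hg f x)] at this
    exact Real.sqrt_eq_one.1 this

theorem HasEikonal.hasGeodesicParametrization (h : HasEikonal g) (hg : IsSmoothMetric g)
    (hout : ∀ x : Space m, 1 ≤ ‖x‖ → g x = 1) :
    HasGeodesicParametrization g := by
  obtain ⟨f, hf, hfo, hf1⟩ := h.exists_global hg hout
  set V := grad g f with hVdef
  set e : Space m := unitVec (Fin.last m) with he
  have hV : ContDiff ℝ ∞ V := contDiff_grad hg hf
  have hVo : ∀ x, 1 ≤ ‖x‖ → V x = e := fun x hx => grad_eq_unitVec hg hout hf hfo hx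
  -- V is a compactly supported perturbation of a constant field, hence bounded and globally
  -- Lipschitz, and its flow is complete.
  have hsupp : HasCompactSupport fun x => V x - e :=
    HasCompactSupport.intro (isCompact_closedBall (0 : Space m) 1) fun x hx => by
      rw [hVo x (le_of_lt (by simpa using hx)), sub_self]
  have hW : ContDiff ℝ ∞ fun x => V x - e := hV.sub contDiff_const
  obtain ⟨K, hK⟩ : ∃ K, LipschitzWith K V := by
    obtain ⟨K, hK⟩ := hW.lipschitzWith_of_hasCompactSupport hsupp (by simp)
    refine ⟨K, LipschitzWith.of_dist_le_mul fun x y => ?_⟩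
    simpa [dist_eq_norm] using hK.dist_le_mul x y
  obtain ⟨L, hL⟩ : ∃ L : NNReal, ∀ x, ‖V x‖ ≤ L := by
    obtain ⟨C, hC⟩ := hW.continuous.bounded_above_of_compact_support hsupp
    refine ⟨Real.toNNReal (C + ‖e‖), fun x => ?_⟩
    refine le_trans ?_ (Real.le_coe_toNNReal _)
    calc ‖V x‖ = ‖(V x - e) + e‖ := by rw [sub_add_cancel]
      _ ≤ _ := (norm_add_le _ _).trans (add_le_add_left (hC x) _)
  obtain ⟨φ, hφ⟩ := ODE.exists_isFlow hK hL
  have hφs := hφ.contDiff hV hK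
  -- Along the flow the derivative of f is df(∇f) = |∇f|² = 1.
  have hfφ : ∀ t x, f (φ t x) = f x + t := by
    intro t x
    have hd : ∀ s, HasDerivAt (fun s => f (φ s x) - s) 0 s := by
      intro s
      have h1 := (hf.differentiable (by simp) (φ s x)).hasFDerivAt.comp_hasDerivAt s
        (hφ.hasDerivAt x s)
      rw [← metricInner_grad hg, hf1] at h1
      rw [← sub_self (1 : ℝ)]
      exact h1.sub (hasDerivAt_id s)
    have := is_const_of_deriv_eq_zero (fun s => (hd s).differentiableAt) (fun s => (hd s).deriv) t 0
    simp only [hφ.zero, sub_zero] at this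
    linarith
  have hgeo : ∀ (x : Space m) (c : ℝ), IsGeodesic g fun t => φ (t + c) x := by
    intro x c
    refine isGeodesic_of_hasDerivAt_grad hg hf hf1 ?_ fun t =>
      (hφ.hasDerivAt x (t + c)).comp_add_const t c
    exact hφs.comp ((contDiff_id.add contDiff_const).prodMk contDiff_const)
  have hdne : ∀ x, fderiv ℝ f x ≠ 0 := by
    intro x hx
    have := hf1 x
    rw [metricInner_grad hg, hx] at this
    simp at this
  have hsph : ∀ x ∈ sphere (0 : Space m) 1, |f x| ≤ 1 := by
    intro x hx
    have hx1 : ‖x‖ = 1 := by simpa using hx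
    rw [hfo x hx1.ge, ← hx1]
    exact PiLp.norm_apply_le x (Fin.last m)
  -- The maximum principle for f and -f gives |f| < 1 in the ball, so the levels ±1 lie where f =
  -- x_n.
  have habs : ∀ x, |f x| = 1 → f x = x (Fin.last m) := by
    intro x hx
    refine hfo x ?_
    by_contra hlt
    have hxb : x ∈ ball (0 : Space m) 1 := by simpa using hlt
    have h1 : f x < 1 := lt_one_of_fderiv_ne_zero hf.continuous (fun y _ => hdne y)
      (fun y hy => (abs_le.1 (hsph y hy)).2) hxb
    have h2 : -f x < 1 := lt_one_of_fderiv_ne_zero (f := fun y => -f y) hf.continuous.neg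
      (fun y _ => by simpa using hdne y)
      (fun y hy => by linarith [(abs_le.1 (hsph y hy)).1]) hxb
    exact absurd hx (ne_of_lt (abs_lt.2 ⟨by linarith, h1⟩))
  have hflast : ∀ x : Space m, |x (Fin.last m)| = 1 → f x = x (Fin.last m) := fun x hx =>
    hfo x (one_le_norm_of_abs_last hx.ge)
  have hcl : ContDiff ℝ ∞ fun x : Space m => x (Fin.last m) := (lastCoord m).contDiff
  have hbase : ∀ x : Space m, (x - (x (Fin.last m) + 1) • e) (Fin.last m) = -1 := by
    intro x
    simp [he]
  -- F projects x onto {x_n = -1} and flows for time x_n + 1. Since f(F x) = x_n, the inverse G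
  -- reads the time from f, flows back to that plane and translates along e_n.
  set F : Space m → Space m := fun x => φ (x (Fin.last m) + 1) (x - (x (Fin.last m) + 1) • e)
    with hF
  set G : Space m → Space m := fun z => φ (-(f z + 1)) z + (f z + 1) • e with hG
  have hFs : ContDiff ℝ ∞ F :=
    hφs.comp ((hcl.add contDiff_const).prodMk
      (contDiff_id.sub ((hcl.add contDiff_const).smul contDiff_const)))
  have hGs : ContDiff ℝ ∞ G :=
    (hφs.comp ((hf.add contDiff_const).neg.prodMk contDiff_id)).add
      ((hf.add contDiff_const).smul contDiff_const)
  have hGF : Function.LeftInverse G F := by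
    intro x
    have h1 : f (F x) = x (Fin.last m) := by
      rw [hF]
      simp only
      rw [hfφ, hflast _ (by rw [hbase]; simp), hbase]
      ring
    simp only [hG]
    rw [h1, hF]
    simp only
    rw [← hφ.add hK, neg_add_cancel, hφ.zero, sub_add_cancel]
  have hFG : Function.RightInverse G F := by
    intro z
    have h1 : φ (-(f z + 1)) z (Fin.last m) = -1 := by
      have h2 : f (φ (-(f z + 1)) z) = -1 := by
        rw [hfφ]
        ring
      rw [← habs _ (by rw [h2]; simp), h2]
    have h3 : G z (Fin.last m) = f z := by
      simp only [hG, PiLp.add_apply, PiLp.smul_apply, h1, he, unitVec_last_apply, smul_eq_mul]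
      ring
    simp only [hF]
    rw [h3]
    simp only [hG]
    rw [add_sub_cancel_right, ← hφ.add hK, add_neg_cancel, hφ.zero]
  have hFp : ∀ (x' : EuclideanSpace ℝ (Fin m)) (t : ℝ),
      F (point x' t) = φ (t + 1) (point x' (-1)) := by
    intro x' t
    simp only [hF, point_last]
    congr 1
    rw [point_eq x' (-1) t, he]
    simp
  refine ⟨⟨⟨⟨F, G, hGF, hFG⟩, hFs.contMDiff, hGs.contMDiff⟩, fun x' => ?_⟩, ?_⟩
  · change IsGeodesic g (fun t => F (point x' t)) ∧ F (point x' (-1)) = point x' (-1) ∧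
      deriv (fun t => F (point x' t)) (-1) = unitVec (Fin.last m)
    simp only [hFp]
    refine ⟨hgeo _ _, by simp [hφ.zero], ?_⟩
    have hd := ((hφ.hasDerivAt (point x' (-1)) ((-1 : ℝ) + 1)).comp_add_const (-1 : ℝ) 1).deriv
    rw [hd, neg_add_cancel, hφ.zero]
    exact hVo _ (one_le_norm_of_abs_last (by simp))
  · intro γ hγ hγ0 hγ1
    have h0 : V (γ (-1)) = e := hVo _ (one_le_norm_of_abs_last (by rw [hγ0]; simp))
    have hd : ∀ t, HasDerivAt (fun t => φ (t + 1) (γ (-1))) (V (φ (t + 1) (γ (-1)))) t := fun t =>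
      (hφ.hasDerivAt (γ (-1)) (t + 1)).comp_add_const t 1
    have heq : γ = fun t => φ (t + 1) (γ (-1)) := by
      refine hγ.eq hg (hgeo (γ (-1)) 1) (t₀ := -1) ?_ ?_
      · simp [hφ.zero]
      · rw [hγ1, (hd (-1)).deriv, neg_add_cancel, hφ.zero, h0]
    have hfγ : ∀ t, f (γ t) = t := by
      intro t
      rw [congrFun heq t]
      rw [hfφ, hflast _ (by rw [hγ0]; simp), hγ0]
      ring
    refine ⟨⟨1, ?_⟩, fun t ht => ?_⟩
    · rw [← habs _ (by rw [hfγ]; simp), hfγ]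
    · have h2 : deriv γ t = V (γ t) := by
        conv_lhs => rw [heq]
        rw [(hd t).deriv, ← congrFun heq t]
      rw [h2]
      exact hVo _ (one_le_norm_of_abs_last (by rw [ht]; simp))

end Eikonal

/-! ### Constant speed and the Gauss lemma -/

section Gauss

/-- Geodesics have constant speed. -/
theorem IsGeodesic.metricInner_deriv_eq (hg : IsSmoothMetric g) {γ : ℝ → Space m}
    (h : IsGeodesic g γ) (s t : ℝ) :
    metricInner g (γ s) (deriv γ s) (deriv γ s) = metricInner g (γ t) (deriv γ t) (deriv γ t) := by
  have hd : ∀ t, HasDerivAt (fun t => metricInner g (γ t) (deriv γ t) (deriv γ t)) 0 t := by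
    intro t
    refine (hasDerivAt_metricInner hg (h.hasDerivAt t) (h.hasDerivAt_deriv t)
      (h.hasDerivAt_deriv t)).congr_deriv ?_
    have := (add_christoffelVec_eq_zero_iff hg).1 ((isGeodesic_iff.1 h).2 t) (deriv γ t)
    rw [metricInner_comm hg (γ t) (deriv γ t)]
    linarith
  exact is_const_of_deriv_eq_zero (fun t => (hd t).differentiableAt) (fun t => (hd t).deriv) s t

variable {F : Space m → Space m}

theorem hasDerivAt_point (x' : EuclideanSpace ℝ (Fin m)) (t : ℝ) :
    HasDerivAt (fun t => point x' t) (unitVec (Fin.last m)) t := by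
  rw [show (fun t => point x' t) = fun t => point x' 0 + (t - 0) • unitVec (Fin.last m) from
    funext (point_eq x' 0)]
  simpa using ((hasDerivAt_id t).smul_const (unitVec (Fin.last m))).const_add (point x' 0)

theorem hasDerivAt_comp_point (hF : ContDiff ℝ ∞ F) (x' : EuclideanSpace ℝ (Fin m)) (t : ℝ) :
    HasDerivAt (fun t => F (point x' t)) (fderiv ℝ F (point x' t) (unitVec (Fin.last m))) t :=
  ((hF.differentiable (by simp) _).hasFDerivAt).comp_hasDerivAt t (hasDerivAt_point x' t)

theorem metricInner_fderiv_last (hg : IsSmoothMetric g) (hout : ∀ x : Space m, 1 ≤ ‖x‖ → g x = 1)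
    (hF : ContDiff ℝ ∞ F)
    (hgeo : ∀ x' : EuclideanSpace ℝ (Fin m), IsGeodesic g (fun t => F (point x' t)) ∧
      F (point x' (-1)) = point x' (-1) ∧
      deriv (fun t => F (point x' t)) (-1) = unitVec (Fin.last m))
    (p : Space m) :
    metricInner g (F p) (fderiv ℝ F p (unitVec (Fin.last m)))
      (fderiv ℝ F p (unitVec (Fin.last m))) = 1 := by
  obtain ⟨x', hx'⟩ := exists_eq_point p
  obtain ⟨h1, h2, h3⟩ := hgeo x'
  have h := h1.metricInner_deriv_eq hg (p (Fin.last m)) (-1)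
  rw [h3, h2, metricInner_unitVec_of_eq_one (hout _ (one_le_norm_of_abs_last (by simp))),
    unitVec_last_apply, (hasDerivAt_comp_point hF x' _).deriv, ← hx'] at h
  exact h

/-- Gauss lemma. -/
theorem metricInner_fderiv_eq_zero (hg : IsSmoothMetric g) (hout : ∀ x : Space m, 1 ≤ ‖x‖ → g x = 1)
    (hF : ContDiff ℝ ∞ F)
    (hgeo : ∀ x' : EuclideanSpace ℝ (Fin m), IsGeodesic g (fun t => F (point x' t)) ∧
      F (point x' (-1)) = point x' (-1) ∧
      deriv (fun t => F (point x' t)) (-1) = unitVec (Fin.last m))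
    {a : Fin (m + 1)} (ha : a ≠ Fin.last m) (p : Space m) :
    metricInner g (F p) (fderiv ℝ F p (unitVec a)) (fderiv ℝ F p (unitVec (Fin.last m))) = 0 := by
  obtain ⟨x', hx'⟩ := exists_eq_point p
  obtain ⟨h1, h2, h3⟩ := hgeo x'
  set e : Space m := unitVec (Fin.last m) with he
  have hF' : ContDiff ℝ ∞ (fderiv ℝ F) := hF.fderiv_right (by simp)
  have hFd : Differentiable ℝ F := hF.differentiable (by simp)
  have hFd' : Differentiable ℝ (fderiv ℝ F) := hF'.differentiable (by simp)
  have hder : deriv (fun t => F (point x' t)) = fun t => fderiv ℝ F (point x' t) e :=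
    funext fun t => (hasDerivAt_comp_point hF x' t).deriv
  -- The unit speed identity holds on every geodesic of the family, so it may be differentiated
  -- across the family, in the direction a.
  have hvar : ∀ q : Space m, metricDeriv g (F q) (fderiv ℝ F q (unitVec a)) (fderiv ℝ F q e)
      (fderiv ℝ F q e) + 2 * metricInner g (F q) (fderiv ℝ F q e)
        (fderiv ℝ (fderiv ℝ F) q (unitVec a) e) = 0 := by
    intro q
    have e0 : HasDerivAt (fun s : ℝ => fderiv ℝ F (q + s • unitVec a) e)
        (fderiv ℝ (fderiv ℝ F) q (unitVec a) e) 0 := by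
      simpa using (hasDerivAt_comp_line (z := unitVec a) (hFd' q)).clm_apply
        (hasDerivAt_const (0 : ℝ) e)
    have e1 := hasDerivAt_metricInner hg (hasDerivAt_comp_line (z := unitVec a) (hFd q)) e0 e0
    have hone := metricInner_fderiv_last hg hout hF hgeo
    rw [← he] at hone
    simp only [hone] at e1
    have e2 := e1.unique (hasDerivAt_const (0 : ℝ) (1 : ℝ))
    simp only [zero_smul, add_zero] at e2
    rw [metricInner_comm hg (F q) (fderiv ℝ (fderiv ℝ F) q (unitVec a) e)] at e2
    linarith
  -- The geodesic equation tested on the variation field, the commuting mixed derivatives of F and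
  -- `hvar` cancel all terms.
  have hd : ∀ t, HasDerivAt (fun t => metricInner g (F (point x' t))
      (deriv (fun t => F (point x' t)) t) (fderiv ℝ F (point x' t) (unitVec a))) 0 t := by
    intro t
    have hp : HasDerivAt (fun t => fderiv ℝ F (point x' t) (unitVec a))
        (fderiv ℝ (fderiv ℝ F) (point x' t) e (unitVec a)) t := by
      simpa using ((hFd' (point x' t)).hasFDerivAt.comp_hasDerivAt t (hasDerivAt_point x' t)).clm_apply
        (hasDerivAt_const t (unitVec a))
    refine (hasDerivAt_metricInner hg (h1.hasDerivAt t) (h1.hasDerivAt_deriv t) hp).congr_deriv ?_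
    have hsymm : fderiv ℝ (fderiv ℝ F) (point x' t) e (unitVec a)
        = fderiv ℝ (fderiv ℝ F) (point x' t) (unitVec a) e :=
      hF.isSymmSndFDerivAt_of_infty _ _ _
    have hgd := (add_christoffelVec_eq_zero_iff hg).1 ((isGeodesic_iff.1 h1).2 t)
      (fderiv ℝ F (point x' t) (unitVec a))
    have hv := hvar (point x' t)
    rw [hsymm]
    have hdt : deriv (fun t => F (point x' t)) t = fderiv ℝ F (point x' t) e := congrFun hder t
    rw [hdt] at hgd ⊢
    linarith
  have hconst := is_const_of_deriv_eq_zero (fun t => (hd t).differentiableAt)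
    (fun t => (hd t).deriv) (p (Fin.last m)) (-1)
  -- F fixes the plane {x_n = -1} pointwise and e_a is tangent to it, so orthogonality at time -1 is
  -- Euclidean.
  have hbase : fderiv ℝ F (point x' (-1)) (unitVec a) = unitVec a := by
    have hline := hasDerivAt_comp_line (z := unitVec a) (hFd (point x' (-1)))
    have hfix : (fun s : ℝ => F (point x' (-1) + s • unitVec a))
        = fun s : ℝ => point x' (-1) + s • unitVec a := by
      ext1 s
      obtain ⟨z, hz⟩ := exists_eq_point (point x' (-1) + s • unitVec a)
      have hl : (point x' (-1) + s • unitVec a : Space m) (Fin.last m) = -1 := by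
        simp [unitVec, ha.symm]
      rw [hl] at hz
      rw [hz]
      exact (hgeo z).2.1
    rw [hfix] at hline
    exact hline.unique (hasDerivAt_add_smul_line _ _)
  rw [h3, hbase, h2, he,
    metricInner_unitVec_of_eq_one (hout _ (one_le_norm_of_abs_last (by simp)))] at hconst
  rw [congrFun hder, ← hx'] at hconst
  rw [metricInner_comm hg, hconst]
  simp [unitVec, ha.symm]

end Gauss

/-! ### Velocity of the geodesics outside the ball -/

section Exterior

/-- The sign of ⟨z, v⟩ decides which half of the line moves away from the origin. -/
theorem one_le_norm_add_smul_or {E : Type*} [NormedAddCommGroup E] [InnerProductSpace ℝ E]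
    {z : E} (hz : 1 ≤ ‖z‖) (v : E) :
    (∀ s : ℝ, 0 ≤ s → 1 ≤ ‖z + s • v‖) ∨ ∀ s : ℝ, s ≤ 0 → 1 ≤ ‖z + s • v‖ := by
  have key : ∀ s : ℝ, 0 ≤ s * inner ℝ z v → 1 ≤ ‖z + s • v‖ := by
    intro s hs
    have h1 : ‖z + s • v‖ ^ 2 = ‖z‖ ^ 2 + 2 * (s * inner ℝ z v) + ‖s • v‖ ^ 2 := by
      rw [norm_add_sq_real, inner_smul_right]
    have h2 : 1 ≤ ‖z + s • v‖ ^ 2 := by nlinarith [sq_nonneg ‖s • v‖]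
    exact (one_le_sq_iff₀ (norm_nonneg _)).1 h2
  rcases le_total 0 (inner ℝ z v) with h | h
  · exact Or.inl fun s hs => key s (mul_nonneg hs h)
  · exact Or.inr fun s hs => key s (mul_nonneg_of_nonpos_of_nonpos hs h)

/-- From an exterior point one of the two half-lines avoids the ball, and the geodesic follows it.
Forwards it is compared with a crossing of {x_n = 1}, backwards with the start on {x_n = -1}; at
both the velocity is e_n. -/
theorem IsGeodesic.deriv_eq_of_one_le_norm (hg : IsSmoothMetric g)
    (hout : ∀ x : Space m, 1 ≤ ‖x‖ → g x = 1) {γ : ℝ → Space m} (hγ : IsGeodesic g γ)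
    (h0 : γ (-1) (Fin.last m) = -1) (h0' : deriv γ (-1) = unitVec (Fin.last m))
    (h1 : ∃ t, γ t (Fin.last m) = 1)
    (h1' : ∀ t, γ t (Fin.last m) = 1 → deriv γ t = unitVec (Fin.last m)) {t₀ : ℝ}
    (ht₀ : 1 ≤ ‖γ t₀‖) : deriv γ t₀ = unitVec (Fin.last m) := by
  rcases lt_or_ge t₀ (-1) with hlt | hge
  · refine ((hγ.deriv_eq_of_line hg hout (a := t₀) (b := -1) (right_mem_Icc.2 hlt.le)
      (fun t ht => one_le_norm_of_abs_last ?_) t₀ (left_mem_Icc.2 hlt.le)).2).trans h0'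
    rw [h0']
    simp only [PiLp.add_apply, PiLp.smul_apply, h0, unitVec_last_apply, smul_eq_mul]
    rw [abs_of_nonpos] <;> linarith [ht.2]
  rcases one_le_norm_add_smul_or ht₀ (deriv γ t₀) with hf | hb
  · obtain ⟨t₁, ht₁⟩ := h1
    rcases le_total t₀ t₁ with hle | hle
    · rw [← h1' t₁ ht₁]
      exact (hγ.deriv_eq_of_line hg hout (a := t₀) (b := t₁) (left_mem_Icc.2 hle)
        (fun t ht => hf _ (sub_nonneg.2 ht.1)) t₁ (right_mem_Icc.2 hle)).2.symm
    -- When the crossing precedes t₀, the line from the crossing along e_n remains in {x_n ≥ 1}, so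
    -- the comparison starts there instead.
    · refine ((hγ.deriv_eq_of_line hg hout (a := t₁) (b := t₀) (left_mem_Icc.2 hle)
        (fun t ht => one_le_norm_of_abs_last ?_) t₀ (right_mem_Icc.2 hle)).2).trans (h1' t₁ ht₁)
      rw [h1' t₁ ht₁]
      simp only [PiLp.add_apply, PiLp.smul_apply, ht₁, unitVec_last_apply, smul_eq_mul]
      rw [abs_of_nonneg] <;> linarith [ht.1]
  · rw [← h0']
    exact (hγ.deriv_eq_of_line hg hout (a := -1) (b := t₀) (right_mem_Icc.2 hge)
      (fun t ht => hb _ (sub_nonpos.2 ht.2)) (-1) (left_mem_Icc.2 hge)).2.symm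

end Exterior

/-! ### Semigeodesic coordinates: from the parametrization, and back to the eikonal equation -/

theorem HasGeodesicParametrization.exists_isSemigeodesic (h : HasGeodesicParametrization g)
    (hg : IsSmoothMetric g) (hout : ∀ x : Space m, 1 ≤ ‖x‖ → g x = 1) :
    ∃ y : OpenPartialHomeomorph (Space m) (Space m), y.target = univ ∧ IsSemigeodesic g y := by
  obtain ⟨⟨F, hgeo⟩, hend⟩ := h
  have hF : ContDiff ℝ ∞ F := F.contMDiff.contDiff
  have hFs : ContDiff ℝ ∞ F.symm := F.symm.contMDiff.contDiff
  -- With y the inverse of F, the coordinate fields are the partial derivatives of F, to which the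
  -- Gauss lemma applies.
  have hco : ∀ a x, coordVector F.toHomeomorph.symm.toOpenPartialHomeomorph a x
      = fderiv ℝ F (F.symm x) (unitVec a) := fun _ _ => rfl
  refine ⟨F.toHomeomorph.symm.toOpenPartialHomeomorph, rfl, ⟨rfl, hFs, hF.contDiffOn⟩, ?_, ?_⟩
  · intro x hx
    obtain ⟨x', hx'⟩ := exists_eq_point (F.symm x)
    obtain ⟨h1, h2, h3⟩ := hgeo x'
    have h2' : F (point x' (-1)) (Fin.last m) = -1 := by rw [h2, point_last]
    obtain ⟨h4, h5⟩ := hend _ h1 h2' h3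
    have hFx : F (point x' (F.symm x (Fin.last m))) = x := by rw [← hx', F.apply_symm_apply]
    have := h1.deriv_eq_of_one_le_norm hg hout h2' h3 h4 h5 (t₀ := F.symm x (Fin.last m))
      (by rw [hFx]; simpa using hx)
    rw [(hasDerivAt_comp_point hF x' _).deriv, ← hx'] at this
    rw [hco, this]
  · intro x
    have hx : F (F.symm x) = x := F.apply_symm_apply x
    have e1 := metricInner_fderiv_last hg hout hF hgeo (F.symm x)
    rw [hx] at e1
    refine ⟨e1, fun a ha => ?_⟩
    have e2 := metricInner_fderiv_eq_zero hg hout hF hgeo ha (F.symm x)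
    rw [hx] at e2
    exact e2

theorem IsSemigeodesic.hasEikonal (hm : 1 ≤ m) (hg : IsSmoothMetric g)
    (hout : ∀ x : Space m, 1 ≤ ‖x‖ → g x = 1)
    {y : OpenPartialHomeomorph (Space m) (Space m)} (h : IsSemigeodesic g y) : HasEikonal g := by
  obtain ⟨⟨hsrc, hy, hys⟩, hext, hblock⟩ := h
  set f : Space m → ℝ := fun x => y x (Fin.last m) with hfdef
  have hf : ContDiff ℝ ∞ f := (lastCoord m).contDiff.comp hy
  have hyd : Differentiable ℝ y := hy.differentiable (by simp)
  have hfd : ∀ x w, fderiv ℝ f x w = (fderiv ℝ y x w) (Fin.last m) := by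
    intro x w
    have := ((lastCoord m).hasFDerivAt.comp x (hyd x).hasFDerivAt).fderiv
    rw [show f = lastCoord m ∘ y from rfl, this]
    rfl
  have hinv : ∀ x w, fderiv ℝ y.symm (y x) (fderiv ℝ y x w) = w := by
    intro x w
    have hx : x ∈ y.source := by rw [hsrc]; exact mem_univ x
    have hs : DifferentiableAt ℝ y.symm (y x) :=
      (hys.contDiffAt (y.open_target.mem_nhds (y.map_source hx))).differentiableAt (by simp)
    have hc := hs.hasFDerivAt.comp x (hyd x).hasFDerivAt
    have hid : y.symm ∘ y = id := by
      ext1 z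
      exact y.left_inv (by rw [hsrc]; exact mem_univ z)
    rw [hid] at hc
    exact congrArg (fun A : Space m →L[ℝ] Space m => A w) (hc.unique (hasFDerivAt_id x))
  -- Expanding w in the coordinate frame, the block form leaves only its ∂_{y_n} component, which is
  -- dy_n(w): ∂_{y_n} is the gradient of y_n.
  have hgrad : ∀ x w, metricInner g x (coordVector y (Fin.last m) x) w = fderiv ℝ f x w := by
    intro x w
    have hw : w = ∑ a, (fderiv ℝ y x w) a • coordVector y a x := by
      conv_lhs => rw [← hinv x w, ← sum_smul_unitVec (fderiv ℝ y x w), map_sum]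
      exact Finset.sum_congr rfl fun a _ => map_smul _ _ _
    have hterm : ∀ a, a ≠ Fin.last m →
        flat g x (coordVector y (Fin.last m) x) ((fderiv ℝ y x w) a • coordVector y a x) = 0 := by
      intro a ha
      rw [map_smul, flat_apply, metricInner_comm hg, (hblock x).2 a ha, smul_zero]
    rw [← flat_apply]
    conv_lhs => rw [hw]
    rw [map_sum, Finset.sum_eq_single (Fin.last m) (fun a _ ha => hterm a ha) (by simp), map_smul,
      flat_apply, (hblock x).1, hfd, smul_eq_mul, mul_one]
  -- Coordinates fix y_n only up to an additive constant. Outside the ball dy_n = dx_n, and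
  -- connectedness of the exterior, where n ≥ 2 enters, makes the constant unique.
  obtain ⟨c, hc⟩ : ∃ c, ∀ x : Space m, 1 ≤ ‖x‖ → f x - lastCoord m x = c := by
    refine exists_eq_const_of_fderiv_eq_zero (f := fun x => f x - lastCoord m x) ?_
      ((hf.differentiable (by simp)).sub (lastCoord m).differentiable) fun x hx => ?_
    · have := Module.lt_rank_of_lt_finrank (R := ℝ) (M := Space m) (n := 1)
        (by rw [finrank_euclideanSpace_fin]; omega)
      simpa using this
    · ext w
      rw [fderiv_fun_sub (hf.differentiable (by simp) x) (lastCoord m).differentiableAt,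
        ContinuousLinearMap.fderiv, _root_.sub_apply, ← hgrad, hext x (by simpa using hx),
        metricInner_unitVec_of_eq_one (hout x hx)]
      simp
  have hu : ContDiff ℝ ∞ fun x => f x - c := hf.sub contDiff_const
  refine ⟨fun x => f x - c, hu.contDiffOn, fun x _ => ?_, fun x hx k => ?_⟩
  · rw [fderiv_sub_const, covectorNorm_eq hg (hgrad x), (hblock x).1, Real.sqrt_one]
  · rw [iteratedFDerivWithin_eq_iteratedFDeriv uniqueDiffOn_closedBall_zero_one
      (hu.contDiffAt.of_le (mod_cast le_top)) (sphere_subset_closedBall hx)]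
    refine iteratedFDeriv_eq_of_eqOn_one_le_norm hu (lastCoord m).contDiff (fun z hz => ?_) k x
      (by simpa using (mem_sphere_zero_iff_norm.1 hx).ge)
    rw [← hc z hz]
    ring

end FixedAngle

/-- Here `n = m + 1 ≥ 2`. The last two conditions are the same one, with the coordinates ranging
over all of `ℝⁿ`, respectively over some open subset of `ℝⁿ`. -/
theorem lemmaA1 (m : ℕ) (hm : 1 ≤ m)
    (g : FixedAngle.Space m → Matrix (Fin (m + 1)) (Fin (m + 1)) ℝ)
    (hg : FixedAngle.IsSmoothMetric g)
    (hout : ∀ x : FixedAngle.Space m, 1 ≤ ‖x‖ → g x = 1) :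
    List.TFAE [
      FixedAngle.HasEikonal g,
      FixedAngle.HasGeodesicParametrization g,
      ∃ y : OpenPartialHomeomorph (FixedAngle.Space m) (FixedAngle.Space m),
        y.target = Set.univ ∧ FixedAngle.IsSemigeodesic g y,
      ∃ y : OpenPartialHomeomorph (FixedAngle.Space m) (FixedAngle.Space m),
        FixedAngle.IsSemigeodesic g y] := by
  tfae_have 1 → 2 := fun h => h.hasGeodesicParametrization hg hout
  tfae_have 2 → 3 := fun h => h.exists_isSemigeodesic hg hout
  tfae_have 3 → 4 := fun ⟨y, _, hy⟩ => ⟨y, hy⟩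
  tfae_have 4 → 1 := fun ⟨_, hy⟩ => hy.hasEikonal hm hg hout
  tfae_finish
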